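/- Let $n>1$ and let $\Omega_1,\dots,\Omega_n\subset\mathbb{R}^d$ be nonempty compact convex sets with $\bigcap_{i=1}^n\Omega_i=\varnothing$. Consider the smallest intersecting ball problem of minimizing $r$ over all $(z,v_1,\dots,v_n,r)$ with $v_i\in\Omega_i$ and $\|z-v_i\|\le r$ for $i=1,\dots,n$ (Euclidean norm). Let $r^*$ be its optimal value, which is positive, let $D$ be the diameter of $\mathrm{conv}\big(\bigcup_{i=1}^n\Omega_i\big)$, and let $R=D/r^*$. For $\varepsilon>0$, a feasible $(z,v_1,\dots,v_n,r)$ with $r\le(1+\varepsilon)r^*$ is called a $(1+\varepsilon)$-approximate solution. The sets are accessible only through a subroutine which, given $h_1,\dots,h_n\in\mathbb{R}^d$, returns $u_1,\dots,u_n$ with $u_i\in\arg\min_{u\in\Omega_i}h_i^{T}u$ for all $i$, each call taking $O(S)$ time. Running time is counted as the number of steps of a real RAM with unit-cost arithmetic operations, square roots, exponentials, logarithms and comparisons on reals, and unit-cost indexing, including the time spent in the subroutine. Then there is an algorithm (one program for all inputs), whose input is $n$, $d$, $\varepsilon$ and access to the subroutine, and which in particular is given neither $D$ nor $r^*$ nor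 $S$, such that for every $0<\varepsilon\le 1$ it computes a $(1+\varepsilon)$-approximate solution in time $$O\Big(\frac{R^2\,(S+nd)\,\log n}{\varepsilon^2}\Big).$$ For $\varepsilon>1$ it also computes a $(1+\varepsilon)$-approximate solution, in time $O\big(R^2(S+nd)\log n\big)$. The constants hidden in these two bounds depend only on the constant in the $O(S)$ bound for the subroutine. -/

import Mathlib

namespace SIB

/-! ## The smallest intersecting ball problem -/

/-- `ℝ^d` with the Euclidean norm. -/
abbrev E (d : ℕ) : Type := EuclideanSpace ℝ (Fin d)

/-- `(z, v₁, …, vₙ, r)` is feasible: `vᵢ ∈ Ωᵢ` and `‖z - vᵢ‖ ≤ r` for all `i`. -/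
def Feasible {n d : ℕ} (Ω : Fin n → Set (E d)) (z : E d) (v : Fin n → E d) (r : ℝ) : Prop :=
  (∀ i, ‖z - v i‖ ≤ r) ∧ ∀ i, v i ∈ Ω i

/-- The optimal value `r*`. For `n ≥ 1` and nonempty `Ωᵢ` this is the infimum of a nonempty set of
nonnegative reals. -/
noncomputable def optRadius {n d : ℕ} (Ω : Fin n → Set (E d)) : ℝ :=
  sInf {r | ∃ z v, Feasible Ω z v r}

/-- `(z, v₁, …, vₙ, r)` is a `(1 + ε)`-approximate solution. -/
def IsApproxSolution {n d : ℕ} (Ω : Fin n → Set (E d)) (ε : ℝ)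
    (z : E d) (v : Fin n → E d) (r : ℝ) : Prop :=
  Feasible Ω z v r ∧ r ≤ (1 + ε) * optRadius Ω

/-- The diameter `D` of the input, that is, of the convex hull of the union of the sets. -/
noncomputable def inputDiam {n d : ℕ} (Ω : Fin n → Set (E d)) : ℝ :=
  Metric.diam (convexHull ℝ (⋃ i, Ω i))

/-- The ratio `R = D / r*`. -/
noncomputable def ratio {n d : ℕ} (Ω : Fin n → Set (E d)) : ℝ :=
  inputDiam Ω / optRadius Ω

/-! ## The linear minimization subroutine -/

/-- A black-box subroutine that maps `h₁, …, hₙ` to vectors `u₁, …, uₙ`. The answer to the `k`-th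
call, and the number of steps that this call takes, may depend on `k`. -/
structure Subroutine (n d : ℕ) where
  answer : ℕ → (Fin n → E d) → (Fin n → E d)
  steps : ℕ → (Fin n → E d) → ℕ

/-- Every answer satisfies `uᵢ ∈ argmin {hᵢᵀ u : u ∈ Ωᵢ}` for all `i`. -/
def Subroutine.Solves {n d : ℕ} (sub : Subroutine n d) (Ω : Fin n → Set (E d)) : Prop :=
  ∀ (k : ℕ) (h : Fin n → E d) (i : Fin n),
    sub.answer k h i ∈ Ω i ∧ ∀ u ∈ Ω i, inner ℝ (h i) (sub.answer k h i) ≤ inner ℝ (h i) u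

/-! ## A real RAM with a subroutine

Programs are finite objects. They use natural-number registers (for counting and addressing) and
real two-dimensional arrays. There is no rounding of reals, and the only constants are natural and
rational numbers. -/

/-- Index expressions. -/
inductive NExpr where
  | const (k : ℕ)
  | reg (x : ℕ)
  | add (a b : NExpr)
  | sub (a b : NExpr)

/-- Real expressions; `cell A i j` is the entry `A[i, j]` of the array with number `A`. -/
inductive RExpr where
  | const (q : ℚ)
  | ofIndex (a : NExpr)
  | cell (A : ℕ) (i j : NExpr)
  | add (a b : RExpr)
  | sub (a b : RExpr)
  | mul (a b : RExpr)
  | div (a b : RExpr)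
  | sqrt (a : RExpr)
  | exp (a : RExpr)
  | log (a : RExpr)

/-- Tests. -/
inductive Test where
  | ltN (a b : NExpr)
  | ltR (a b : RExpr)
  | neg (a : Test)
  | conj (a b : Test)

/-- Programs. `call H U` hands the rows of the array `H` to the subroutine and stores the answer in
the rows of the array `U`. -/
inductive Prog where
  | skip
  | setReg (x : ℕ) (a : NExpr)
  | setCell (A : ℕ) (i j : NExpr) (a : RExpr)
  | call (H U : ℕ)
  | seq (p q : Prog)
  | branch (b : Test) (p q : Prog)
  | loop (b : Test) (p : Prog)

/-- Memory contents, and the number of subroutine calls made so far. -/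
structure State where
  reg : ℕ → ℕ
  mem : ℕ → ℕ → ℕ → ℝ
  calls : ℕ

/-- Value of an index expression (subtraction is truncated). -/
def NExpr.val (s : State) : NExpr → ℕ
  | const k => k
  | reg x => s.reg x
  | add a b => a.val s + b.val s
  | sub a b => a.val s - b.val s

/-- Number of steps needed to evaluate an index expression: one per node. -/
def NExpr.cost : NExpr → ℕ
  | const _ => 1
  | reg _ => 1
  | add a b => a.cost + b.cost + 1
  | sub a b => a.cost + b.cost + 1

/-- Value of a real expression. Outside their domains, `/`, `√` and `log` follow the conventions of
Mathlib, which a program could imitate with boundedly many tests. -/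
noncomputable def RExpr.val (s : State) : RExpr → ℝ
  | const q => (q : ℝ)
  | ofIndex a => (a.val s : ℝ)
  | cell A i j => s.mem A (i.val s) (j.val s)
  | add a b => a.val s + b.val s
  | sub a b => a.val s - b.val s
  | mul a b => a.val s * b.val s
  | div a b => a.val s / b.val s
  | sqrt a => Real.sqrt (a.val s)
  | exp a => Real.exp (a.val s)
  | log a => Real.log (a.val s)

/-- Number of steps needed to evaluate a real expression: one per node. -/
def RExpr.cost : RExpr → ℕ
  | const _ => 1
  | ofIndex a => a.cost + 1
  | cell _ i j => i.cost + j.cost + 1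
  | add a b => a.cost + b.cost + 1
  | sub a b => a.cost + b.cost + 1
  | mul a b => a.cost + b.cost + 1
  | div a b => a.cost + b.cost + 1
  | sqrt a => a.cost + 1
  | exp a => a.cost + 1
  | log a => a.cost + 1

/-- Truth of a test. -/
def Test.holds (s : State) : Test → Prop
  | ltN a b => a.val s < b.val s
  | ltR a b => a.val s < b.val s
  | neg a => ¬ a.holds s
  | conj a b => a.holds s ∧ b.holds s

/-- Number of steps needed to evaluate a test: one per node. -/
def Test.cost : Test → ℕ
  | ltN a b => a.cost + b.cost + 1
  | ltR a b => a.cost + b.cost + 1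
  | neg a => a.cost + 1
  | conj a b => a.cost + b.cost + 1

/-- The vector in `ℝ^d` stored in row `i` of the array `A`. -/
def State.row (s : State) (d A i : ℕ) : E d :=
  WithLp.toLp 2 fun j : Fin d => s.mem A i j

/-- The vectors stored in rows `0, …, n - 1` of the array `A`. -/
def State.rows (s : State) (n d A : ℕ) : Fin n → E d :=
  fun i => s.row d A i

/-- Store `m` in register `x`. -/
def State.putReg (s : State) (x m : ℕ) : State :=
  { s with reg := fun y => if y = x then m else s.reg y }

/-- Store `a` in the cell `A[i, j]`. -/
def State.putCell (s : State) (A i j : ℕ) (a : ℝ) : State :=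
  { s with mem := fun B k l => if B = A ∧ k = i ∧ l = j then a else s.mem B k l }

/-- Store the vectors `u₁, …, uₙ` in rows `0, …, n - 1` of the array `A`. -/
def State.putRows (s : State) {n d : ℕ} (A : ℕ) (u : Fin n → E d) : State :=
  { s with mem := fun B k l =>
      if h : B = A ∧ k < n ∧ l < d then u ⟨k, h.2.1⟩ ⟨l, h.2.2⟩ else s.mem B k l }

/-- `Exec sub p s s' t`: started in `s`, the program `p` halts in the state `s'` after `t` steps,
where the steps of the subroutine are included. -/
inductive Exec {n d : ℕ} (sub : Subroutine n d) : Prog → State → State → ℕ → Prop where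
  | skip (s : State) : Exec sub .skip s s 1
  | setReg (x : ℕ) (a : NExpr) (s : State) :
      Exec sub (.setReg x a) s (s.putReg x (a.val s)) (a.cost + 1)
  | setCell (A : ℕ) (i j : NExpr) (a : RExpr) (s : State) :
      Exec sub (.setCell A i j a) s (s.putCell A (i.val s) (j.val s) (a.val s))
        (i.cost + j.cost + a.cost + 1)
  | call (H U : ℕ) (s : State) :
      Exec sub (.call H U) s
        { s.putRows U (sub.answer s.calls (s.rows n d H)) with calls := s.calls + 1 }
        (sub.steps s.calls (s.rows n d H) + 1)
  | seq {p q : Prog} {s s' s'' : State} {t t' : ℕ} :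
      Exec sub p s s' t → Exec sub q s' s'' t' → Exec sub (.seq p q) s s'' (t + t')
  | branchTrue {b : Test} {p q : Prog} {s s' : State} {t : ℕ} :
      b.holds s → Exec sub p s s' t → Exec sub (.branch b p q) s s' (b.cost + t)
  | branchFalse {b : Test} {p q : Prog} {s s' : State} {t : ℕ} :
      ¬ b.holds s → Exec sub q s s' t → Exec sub (.branch b p q) s s' (b.cost + t)
  | loopTrue {b : Test} {p : Prog} {s s' s'' : State} {t t' : ℕ} :
      b.holds s → Exec sub p s s' t → Exec sub (.loop b p) s' s'' t' →
        Exec sub (.loop b p) s s'' (b.cost + t + t')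
  | loopFalse {b : Test} {p : Prog} {s : State} :
      ¬ b.holds s → Exec sub (.loop b p) s s b.cost

/-- Execution is deterministic: the final state and the number of steps are unique. -/
theorem Exec.deterministic {n d : ℕ} {sub : Subroutine n d} {p : Prog} {s s₁ s₂ : State}
    {t₁ t₂ : ℕ} (h₁ : Exec sub p s s₁ t₁) (h₂ : Exec sub p s s₂ t₂) : s₁ = s₂ ∧ t₁ = t₂ := by
  induction h₁ generalizing s₂ t₂ with
  | skip => cases h₂; exact ⟨rfl, rfl⟩
  | setReg => cases h₂; exact ⟨rfl, rfl⟩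
  | setCell => cases h₂; exact ⟨rfl, rfl⟩
  | call => cases h₂; exact ⟨rfl, rfl⟩
  | seq _ _ ih ih' =>
    cases h₂ with
    | seq a b =>
      obtain ⟨rfl, rfl⟩ := ih a
      obtain ⟨rfl, rfl⟩ := ih' b
      exact ⟨rfl, rfl⟩
  | branchTrue hb _ ih =>
    cases h₂ with
    | branchTrue _ a => obtain ⟨rfl, rfl⟩ := ih a; exact ⟨rfl, rfl⟩
    | branchFalse hb' _ => exact absurd hb hb'
  | branchFalse hb _ ih =>
    cases h₂ with
    | branchTrue hb' _ => exact absurd hb' hb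
    | branchFalse _ a => obtain ⟨rfl, rfl⟩ := ih a; exact ⟨rfl, rfl⟩
  | loopTrue hb _ _ ih ih' =>
    cases h₂ with
    | loopTrue _ a b =>
      obtain ⟨rfl, rfl⟩ := ih a
      obtain ⟨rfl, rfl⟩ := ih' b
      exact ⟨rfl, rfl⟩
    | loopFalse hb' => exact absurd hb hb'
  | loopFalse hb =>
    cases h₂ with
    | loopTrue hb' _ _ => exact absurd hb' hb
    | loopFalse _ => exact ⟨rfl, rfl⟩

/-- The initial state: registers `0` and `1` hold `n` and `d`, the cell `0[0, 0]` holds `ε`, and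
the rest of the memory is zero. -/
def State.input (n d : ℕ) (ε : ℝ) : State where
  reg := fun x => if x = 0 then n else if x = 1 then d else 0
  mem := fun A i j => if A = 0 ∧ i = 0 ∧ j = 0 then ε else 0
  calls := 0

/-- The output point `z`: row `0` of the array `1`. -/
def State.outZ (s : State) (d : ℕ) : E d := s.row d 1 0

/-- The output points `v₁, …, vₙ`: rows `0, …, n - 1` of the array `2`. -/
def State.outV (s : State) (n d : ℕ) : Fin n → E d := s.rows n d 2

/-- The output radius `r`: the cell `3[0, 0]`. -/
def State.outR (s : State) : ℝ := s.mem 3 0 0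

end SIB

namespace SIB

variable {n d : ℕ}

/-! The problem is treated as a game: choose `z` and the `vᵢ ∈ Ωᵢ` to make `∑ ⟨yᵢ, z - vᵢ⟩` small,
against dual vectors with `∑ ‖yᵢ‖ ≤ 1`. Conversely, for duals that sum to zero this value does not
depend on `z`, so `∑ ⟨yᵢ, z - vᵢ⟩`, minimized over `vᵢ ∈ Ωᵢ`, bounds `r*` from below. One phase
plays the game for `t` rounds with step size `θ` and a guess `D` for the distance of all answers
from a reference point `c`.

The duals come from the gradient of the logarithm of a softmax potential, the sum of `exp` of
smoothed norms of `(θ/D)(Z - Vᵢ)`, where `Z` and `Vᵢ` are the running sums. The answers `vᵢ` are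
best responses, found by the subroutine. The centre is a regularized leader in the ball of radius
`2D` about `c`; it penalizes the sum `S` of all duals for being nonzero (`RoundInv.step`). At the
end the duals are corrected by `S/n` to sum to zero; the errors proportional to `‖S‖` are absorbed
by the centre's regret bound, and after `(3 + log n)/θ²` rounds the averages have radius at most `r*
+ 18θD` (`RoundInv.norm_sub_le`).

Neither the diameter nor `r*` is known. With an upper bound `ρ` for `r*` and `θ = eρ/(72D)`, `e =
min ε 1`, the error is `eρ/4`. If an answer was farther than `D` from `c`, `D` is doubled;
otherwise, if the radius found is below `ρ/2`, `ρ` is halved; otherwise the result is good enough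
(`Runs.phase`). Every unsuccessful phase doubles `D/ρ`, which starts at `1` and stays at most `2R`.
A phase takes a number of rounds of order `(D/ρ)² log n / e²`, so the costs grow geometrically and
the last phase dominates (`Runs.phases`); hence the guessing costs no extra logarithm.

The remaining lemmas show that the programs do this, at cost `O(S + nd)` per round. -/

/-- The smoothed norm `√(1 + ‖x‖²)`. -/
noncomputable def smoothNorm (x : E d) : ℝ := √(1 + ‖x‖ ^ 2)

theorem smoothNorm_sq (x : E d) : smoothNorm x ^ 2 = 1 + ‖x‖ ^ 2 :=
  Real.sq_sqrt (by positivity)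

theorem one_le_smoothNorm (x : E d) : 1 ≤ smoothNorm x :=
  Real.one_le_sqrt.2 (by nlinarith [sq_nonneg ‖x‖])

theorem smoothNorm_pos (x : E d) : 0 < smoothNorm x :=
  zero_lt_one.trans_le (one_le_smoothNorm x)

theorem norm_le_smoothNorm (x : E d) : ‖x‖ ≤ smoothNorm x :=
  Real.le_sqrt_of_sq_le (by linarith)

@[simp] theorem smoothNorm_zero : smoothNorm (0 : E d) = 1 := by simp [smoothNorm]

/-- The square root lies below its tangent, and the quadratic error `‖g‖² / (2 * smoothNorm x)` is
at most `‖g‖² / 2` because the smoothed norm is at least `1`. -/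
theorem smoothNorm_add_le (x g : E d) :
    smoothNorm (x + g) ≤ smoothNorm x + inner ℝ x g / smoothNorm x + ‖g‖ ^ 2 / 2 := by
  have ha := one_le_smoothNorm x
  have ha2 := smoothNorm_sq x
  have hb2 := smoothNorm_sq (x + g)
  rw [norm_add_sq_real] at hb2
  set a := smoothNorm x
  set b := smoothNorm (x + g)
  have ha0 : 0 < a := by linarith
  have h1 : inner ℝ x g / a = (b ^ 2 - a ^ 2 - ‖g‖ ^ 2) / (2 * a) := by
    rw [hb2, ha2]; field_simp; ring
  have h2 : ‖g‖ ^ 2 / 2 ≥ ‖g‖ ^ 2 / (2 * a) := by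
    apply div_le_div_of_nonneg_left (by positivity) (by norm_num); linarith
  have h3 : b ≤ a + (b ^ 2 - a ^ 2) / (2 * a) := by
    rw [← sub_nonneg]
    have : a + (b ^ 2 - a ^ 2) / (2 * a) - b = (b - a) ^ 2 / (2 * a) := by field_simp; ring
    rw [this]; positivity
  have h4 : (b ^ 2 - a ^ 2 - ‖g‖ ^ 2) / (2 * a)
      = (b ^ 2 - a ^ 2) / (2 * a) - ‖g‖ ^ 2 / (2 * a) := by rw [sub_div]
  linarith

theorem exp_smoothNorm_add_le (x g : E d) {b : ℝ} (hg : ‖g‖ ≤ b) (hb : b ≤ 1 / 4) :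
    Real.exp (smoothNorm (x + g)) ≤
      Real.exp (smoothNorm x) * (1 + inner ℝ x g / smoothNorm x + 16 / 9 * b ^ 2) := by
  have hb0 : 0 ≤ b := (norm_nonneg g).trans hg
  have hq := smoothNorm_pos x
  have hin : |inner ℝ x g / smoothNorm x| ≤ b := by
    rw [abs_div, abs_of_pos hq, div_le_iff₀ hq]
    calc |inner ℝ x g| ≤ ‖x‖ * ‖g‖ := abs_real_inner_le_norm x g
      _ ≤ smoothNorm x * b := by
        gcongr; exact norm_le_smoothNorm x
      _ = b * smoothNorm x := mul_comm _ _
  have hadd := smoothNorm_add_le x g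
  set y := inner ℝ x g / smoothNorm x
  have hg2 : ‖g‖ ^ 2 ≤ b ^ 2 := by gcongr
  obtain ⟨hy1, hy2⟩ := abs_le.1 hin
  -- For `b ≤ 1/4` one has `|w| ≤ b + b²/2 ≤ 9b/8`, and the quadratic terms add up to `(1/2 + 81/64)
  -- b² ≤ 16/9 b²`.
  set w := y + b ^ 2 / 2
  have hw : |w| ≤ 9 / 8 * b := by
    rw [abs_le]; constructor <;> simp only [w] <;> nlinarith
  have hexp : Real.exp w ≤ 1 + w + w ^ 2 := by
    have := Real.abs_exp_sub_one_sub_id_le (x := w) (by linarith)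
    linarith [(abs_le.1 this).2]
  have hw2 : w ^ 2 ≤ (9 / 8 * b) ^ 2 := sq_le_sq' (by linarith [(abs_le.1 hw).1]) (abs_le.1 hw).2
  calc Real.exp (smoothNorm (x + g)) ≤ Real.exp (smoothNorm x + w) :=
        Real.exp_le_exp.2 (by simp only [w]; linarith)
    _ = Real.exp (smoothNorm x) * Real.exp w := Real.exp_add _ _
    _ ≤ _ := by
      gcongr
      refine hexp.trans ?_
      simp only [w] at hw2 ⊢
      nlinarith

/-! ### Basic facts on the problem -/

theorem Feasible.nonneg {Ω : Fin n → Set (E d)} {z v r} (hn : 1 < n) (h : Feasible Ω z v r) :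
    0 ≤ r := (norm_nonneg _).trans (h.1 ⟨0, by omega⟩)

theorem optRadius_le {Ω : Fin n → Set (E d)} (hn : 1 < n) {z v r} (h : Feasible Ω z v r) :
    optRadius Ω ≤ r :=
  csInf_le ⟨0, fun _ ⟨_, _, h⟩ => h.nonneg hn⟩ ⟨z, v, h⟩

theorem le_optRadius {Ω : Fin n → Set (E d)} (hne : ∀ i, (Ω i).Nonempty) {a : ℝ}
    (h : ∀ z v r, Feasible Ω z v r → a ≤ r) : a ≤ optRadius Ω := by
  choose v hv using hne
  refine le_csInf ⟨‖fun i => (0 : E d) - v i‖, 0, v,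
    fun i => norm_le_pi_norm (fun i => (0 : E d) - v i) i, hv⟩ ?_
  rintro r ⟨z, v, h'⟩
  exact h z v r h'

/-- By compactness the largest distance `‖vᵢ - v₀‖` has a minimum over all choices `vᵢ ∈ Ωᵢ`. It is
positive, since zero would give a common point, and by the triangle inequality it is at most twice
the radius of any feasible solution. -/
theorem optRadius_pos {Ω : Fin n → Set (E d)} (hn : 1 < n) (hne : ∀ i, (Ω i).Nonempty)
    (hcpt : ∀ i, IsCompact (Ω i)) (hemp : (⋂ i, Ω i) = ∅) : 0 < optRadius Ω := by
  let i₀ : Fin n := ⟨0, by omega⟩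
  obtain ⟨v, hv, hmin⟩ := (isCompact_univ_pi hcpt).exists_isMinOn
    (Set.univ_pi_nonempty_iff.2 hne)
    (f := fun v : Fin n → E d => ‖fun i => v i - v i₀‖) (by fun_prop)
  have hpos : 0 < ‖fun i => v i - v i₀‖ := by
    rw [norm_pos_iff]
    intro h0
    have : v i₀ ∈ ⋂ i, Ω i := by
      rw [Set.mem_iInter]
      intro i
      have : v i = v i₀ := sub_eq_zero.1 (congrFun h0 i)
      rw [← this]
      exact hv i trivial
    rw [hemp] at this
    exact this
  refine (half_pos hpos).trans_le (le_optRadius hne fun z v' r h => ?_)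
  have h1 := isMinOn_iff.1 hmin v' (fun i _ => h.2 i)
  have h2 : ‖fun i => v' i - v' i₀‖ ≤ 2 * r := by
    rw [pi_norm_le_iff_of_nonneg (by linarith [h.nonneg hn])]
    intro i
    have : v' i - v' i₀ = (z - v' i₀) - (z - v' i) := by abel
    rw [this]
    linarith [norm_sub_le (z - v' i₀) (z - v' i), h.1 i, h.1 i₀]
  linarith

theorem norm_sub_le_inputDiam {Ω : Fin n → Set (E d)} (hcpt : ∀ i, IsCompact (Ω i)) {i j : Fin n}
    {x y : E d} (hx : x ∈ Ω i) (hy : y ∈ Ω j) : ‖x - y‖ ≤ inputDiam Ω := by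
  rw [← dist_eq_norm]
  refine Metric.dist_le_diam_of_mem ?_ ?_ ?_
  · rw [isBounded_convexHull]
    exact (isCompact_iUnion hcpt).isBounded
  · exact subset_convexHull ℝ _ (Set.mem_iUnion_of_mem i hx)
  · exact subset_convexHull ℝ _ (Set.mem_iUnion_of_mem j hy)

/-! ### One round of the algorithm -/

/-- Weights of the sets. -/
noncomputable def weight (η : ℝ) (Z : E d) (V : Fin n → E d) (i : Fin n) : ℝ :=
  Real.exp (smoothNorm (η • (Z - V i)))

/-- The dual vectors. -/
noncomputable def dualVec (η : ℝ) (Z : E d) (V : Fin n → E d) (i : Fin n) : E d :=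
  (weight η Z V i / ((∑ k, weight η Z V k) * smoothNorm (η • (Z - V i)))) • (η • (Z - V i))

/-- The next centre. -/
noncomputable def nextCentre (D θ : ℝ) (c S : E d) : E d :=
  c - (2 * D / smoothNorm (θ • S)) • (θ • S)

theorem weight_pos (η : ℝ) (Z : E d) (V : Fin n → E d) (i : Fin n) : 0 < weight η Z V i :=
  Real.exp_pos _

theorem sum_weight_pos (hn : 1 < n) (η : ℝ) (Z : E d) (V : Fin n → E d) :
    0 < ∑ k, weight η Z V k :=
  Finset.sum_pos (fun i _ => weight_pos η Z V i) ⟨⟨0, by omega⟩, Finset.mem_univ _⟩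

/-- Each dual vector is a softmax probability times the gradient `x / smoothNorm x`, which has norm
at most `1`. -/
theorem sum_norm_dualVec_le (hn : 1 < n) (η : ℝ) (Z : E d) (V : Fin n → E d) :
    ∑ i, ‖dualVec η Z V i‖ ≤ 1 := by
  have hW := sum_weight_pos hn η Z V
  have h1 : ∀ i, ‖dualVec η Z V i‖ ≤ weight η Z V i / ∑ k, weight η Z V k := by
    intro i
    have hq := smoothNorm_pos (η • (Z - V i))
    have hq' := norm_le_smoothNorm (η • (Z - V i))
    have hw := weight_pos η Z V i
    rw [dualVec, norm_smul]
    generalize (∑ k, weight η Z V k) = W at *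
    generalize η • (Z - V i) = x at *
    rw [Real.norm_of_nonneg (by positivity), div_mul_eq_mul_div, mul_comm W,
      div_le_div_iff₀ (by positivity) hW, mul_assoc]
    gcongr
  refine (Finset.sum_le_sum fun i _ => h1 i).trans_eq ?_
  rw [← Finset.sum_div, div_self hW.ne']

/-- The displacement from `c` is `-2D` times the gradient of the smoothed norm at `θ • S`, hence it
stays in the ball of radius `2D`. -/
theorem norm_nextCentre_sub_le {D : ℝ} (hD : 0 ≤ D) (θ : ℝ) (c S : E d) :
    ‖nextCentre D θ c S - c‖ ≤ 2 * D := by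
  have hq := smoothNorm_pos (θ • S)
  rw [nextCentre, sub_sub_cancel_left, norm_neg, norm_smul, Real.norm_of_nonneg (by positivity)]
  calc _ ≤ 2 * D / smoothNorm (θ • S) * smoothNorm (θ • S) := by
        gcongr; exact norm_le_smoothNorm _
    _ = _ := by field_simp

/-! ### Regret analysis of a phase -/

/-- The invariant of the rounds of a phase. -/
def RoundInv (Ω : Fin n → Set (E d)) (c : E d) (D θ t : ℝ) (Z S : E d) (V Y : Fin n → E d) :
    Prop :=
  -- `A` accumulates the game values `∑ ⟨yᵢ, z - vᵢ⟩` and `B` the centre's share `⟨∑ yᵢ, z - c⟩`.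
  -- The difference `A - B` is the part that the best responses control, the bound on the weights is
  -- the potential argument, and the last inequality is the regret of the centre.
  ∃ A B : ℝ, (∑ i, Y i = S) ∧ (∑ i, ‖Y i‖ ≤ t) ∧
    (∀ u : Fin n → E d, (∀ i, u i ∈ Ω i) → A - B ≤ ∑ i, inner ℝ (Y i) (c - u i)) ∧
    (∑ i, weight (θ / D) Z V i ≤ n * Real.exp (1 + θ / D * A + 16 * θ ^ 2 * t)) ∧
    2 * D * smoothNorm (θ • S) + θ * B ≤ 2 * D + D * θ ^ 2 * t

theorem RoundInv.zero (Ω : Fin n → Set (E d)) (c : E d) (D θ : ℝ) :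
    RoundInv Ω c D θ 0 0 0 0 0 :=
  ⟨0, 0, by simp, by simp, by simp, by simp [weight], by simp⟩

/-- Up to second order, the relative growth of the potential is `η` times the value of the current
round, since the dual vectors are the gradient of its logarithm divided by `η`. Then `1 + x ≤ exp x`
is used. -/
theorem sum_weight_add_le (hn : 1 < n) {η b : ℝ} {Z z : E d} {V v : Fin n → E d}
    (hg : ∀ i, ‖η • (z - v i)‖ ≤ b) (hb : b ≤ 1 / 4) :
    ∑ i, weight η (Z + z) (V + v) i ≤ (∑ i, weight η Z V i) *
      Real.exp (η * (∑ i, inner ℝ (dualVec η Z V i) (z - v i)) + 16 / 9 * b ^ 2) := by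
  have hW := sum_weight_pos hn η Z V
  set W := ∑ i, weight η Z V i with hWdef
  have h1 : ∀ i, weight η (Z + z) (V + v) i ≤ weight η Z V i +
      W * (η * inner ℝ (dualVec η Z V i) (z - v i)) + weight η Z V i * (16 / 9 * b ^ 2) := by
    intro i
    have h := exp_smoothNorm_add_le (η • (Z - V i)) (η • (z - v i)) (hg i) hb
    have hq := smoothNorm_pos (η • (Z - V i))
    have e1 : η • (Z + z - (V + v) i) = η • (Z - V i) + η • (z - v i) := by
      rw [← smul_add, Pi.add_apply, add_sub_add_comm]
    rw [weight, e1]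
    refine h.trans_eq ?_
    rw [dualVec, real_inner_smul_left (η • (Z - V i)) (z - v i), inner_smul_right, ← hWdef]
    simp only [weight]
    field_simp
  calc _ ≤ ∑ i, (weight η Z V i +
      W * (η * inner ℝ (dualVec η Z V i) (z - v i)) + weight η Z V i * (16 / 9 * b ^ 2)) :=
        Finset.sum_le_sum fun i _ => h1 i
    _ = W * (η * (∑ i, inner ℝ (dualVec η Z V i) (z - v i)) + 16 / 9 * b ^ 2 + 1) := by
        rw [Finset.sum_add_distrib, Finset.sum_add_distrib, ← Finset.mul_sum, ← Finset.mul_sum,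
          ← Finset.sum_mul, ← hWdef]
        ring
    _ ≤ _ := by
        gcongr
        exact Real.add_one_le_exp _

theorem RoundInv.step {Ω : Fin n → Set (E d)} {c : E d} {D θ t : ℝ} {Z S : E d}
    {V Y v : Fin n → E d} (hn : 1 < n) (hD : 0 < D) (hθ : 0 < θ) (hθ1 : θ ≤ 1 / 72)
    (h : RoundInv Ω c D θ t Z S V Y)
    (hv : ∀ i, ∀ u ∈ Ω i, inner ℝ (-dualVec (θ / D) Z V i) (v i) ≤
      inner ℝ (-dualVec (θ / D) Z V i) u)
    (hvD : ∀ i, ‖v i - c‖ ≤ D) :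
    RoundInv Ω c D θ (t + 1) (Z + nextCentre D θ c S) (S + ∑ i, dualVec (θ / D) Z V i)
      (V + v) (Y + dualVec (θ / D) Z V) := by
  obtain ⟨A, B, hYS, hYt, hAB, hpot, hS⟩ := h
  set z := nextCentre D θ c S with hz
  set y := dualVec (θ / D) Z V with hy
  have hzc : ‖z - c‖ ≤ 2 * D := norm_nextCentre_sub_le hD.le θ c S
  have hy1 : ∑ i, ‖y i‖ ≤ 1 := sum_norm_dualVec_le hn _ _ _
  refine ⟨A + ∑ i, inner ℝ (y i) (z - v i), B + inner ℝ (∑ i, y i) (z - c), ?_, ?_, ?_, ?_, ?_⟩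
  · simp only [Pi.add_apply, Finset.sum_add_distrib, hYS]
  · calc _ ≤ ∑ i, (‖Y i‖ + ‖y i‖) := Finset.sum_le_sum fun i _ => norm_add_le _ _
      _ ≤ _ := by rw [Finset.sum_add_distrib]; linarith
  · intro u hu
    have h1 := hAB u hu
    -- Here the term `⟨∑ yᵢ, z - c⟩` cancels, and the answers `vᵢ` maximize `⟨yᵢ, ·⟩` over `Ωᵢ`.
    have h2 : ∑ i, inner ℝ (y i) (z - v i) - inner ℝ (∑ i, y i) (z - c)
        ≤ ∑ i, inner ℝ (y i) (c - u i) := by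
      rw [sum_inner, ← Finset.sum_sub_distrib]
      refine Finset.sum_le_sum fun i _ => ?_
      have := hv i (u i) (hu i)
      simp only [inner_neg_left, inner_sub_right] at this ⊢
      linarith
    simp only [Pi.add_apply, inner_add_left, Finset.sum_add_distrib]
    linarith
  · have hg : ∀ i, ‖(θ / D) • (z - v i)‖ ≤ 3 * θ := by
      intro i
      have : ‖z - v i‖ ≤ 3 * D := by
        have : z - v i = (z - c) - (v i - c) := by abel
        rw [this]
        linarith [norm_sub_le (z - c) (v i - c), hvD i]
      rw [norm_smul, Real.norm_of_nonneg (by positivity)]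
      calc _ ≤ θ / D * (3 * D) := by gcongr
        _ = _ := by field_simp
    refine (sum_weight_add_le hn hg (by linarith)).trans ?_
    calc _ ≤ n * Real.exp (1 + θ / D * A + 16 * θ ^ 2 * t) *
          Real.exp (θ / D * (∑ i, inner ℝ (y i) (z - v i)) + 16 / 9 * (3 * θ) ^ 2) := by
          gcongr
      _ = _ := by
          rw [mul_assoc, ← Real.exp_add]
          congr 2
          ring
  · have hs1 : ‖∑ i, y i‖ ≤ 1 := (norm_sum_le _ _).trans hy1
    have hq := smoothNorm_pos (θ • S)
    have h1 := smoothNorm_add_le (θ • S) (θ • ∑ i, y i)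
    rw [← smul_add] at h1
    have h2 : ‖θ • ∑ i, y i‖ ^ 2 ≤ θ ^ 2 := by
      rw [norm_smul, Real.norm_of_nonneg hθ.le, mul_pow]
      have : ‖∑ i, y i‖ ^ 2 ≤ 1 := pow_le_one₀ (norm_nonneg _) hs1
      nlinarith [sq_nonneg θ]
    -- The choice of the centre makes this exactly the negative of the first-order change of `2D *
    -- smoothNorm (θ • S)`.
    have h3 : θ * inner ℝ (∑ i, y i) (z - c) =
        -(2 * D * (inner ℝ (θ • S) (θ • ∑ i, y i) / smoothNorm (θ • S))) := by
      rw [hz, nextCentre, sub_sub_cancel_left, inner_neg_right, inner_smul_right,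
        real_inner_comm, real_inner_smul_right (θ • S)]
      ring
    have h4 := mul_le_mul_of_nonneg_left h1 (by positivity : 0 ≤ 2 * D)
    nlinarith

/-- The guarantee after the last round. -/
theorem RoundInv.norm_sub_le {Ω : Fin n → Set (E d)} {c : E d} {D θ t : ℝ} {Z S : E d}
    {V Y u : Fin n → E d} (hn : 1 < n) (hne : ∀ i, (Ω i).Nonempty) (hD : 0 < D) (hθ : 0 < θ)
    (ht : (3 + Real.log n) / θ ^ 2 ≤ t) (h : RoundInv Ω c D θ t Z S V Y)
    (hu : ∀ i, u i ∈ Ω i)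
    (hmin : ∀ i, ∀ x ∈ Ω i, inner ℝ (-(Y i - (n : ℝ)⁻¹ • S)) (u i) ≤
      inner ℝ (-(Y i - (n : ℝ)⁻¹ • S)) x)
    (huD : ∀ i, ‖u i - c‖ ≤ D) (hopt : optRadius Ω ≤ D) (i : Fin n) :
    ‖Z - V i‖ ≤ (optRadius Ω + 18 * θ * D) * t := by
  obtain ⟨A, B, hYS, hYt, hAB, hpot, hS⟩ := h
  have hn0 : (0 : ℝ) < n := by exact_mod_cast (by omega : 0 < n)
  have hY0 : ∑ i, (Y i - (n : ℝ)⁻¹ • S) = 0 := by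
    rw [Finset.sum_sub_distrib, hYS, Finset.sum_const, Finset.card_univ, Fintype.card_fin,
      ← Nat.cast_smul_eq_nsmul ℝ, smul_smul, mul_inv_cancel₀ hn0.ne', one_smul, sub_self]
  have hYn : ∑ i, ‖Y i - (n : ℝ)⁻¹ • S‖ ≤ t + ‖S‖ := by
    calc _ ≤ ∑ i, (‖Y i‖ + (n : ℝ)⁻¹ * ‖S‖) := by
          refine Finset.sum_le_sum fun i _ => (_root_.norm_sub_le _ _).trans_eq ?_
          rw [norm_smul, Real.norm_of_nonneg (by positivity)]
      _ = ∑ i, ‖Y i‖ + ‖S‖ := by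
          rw [Finset.sum_add_distrib, Finset.sum_const, Finset.card_univ, Fintype.card_fin,
            nsmul_eq_mul]
          field_simp
      _ ≤ _ := by linarith
  -- Because the corrected duals sum to zero, the value does not depend on the centre.
  have hshift : ∀ (x : E d) (w : Fin n → E d), ∑ i, inner ℝ (Y i - (n : ℝ)⁻¹ • S) (x - w i) =
      ∑ i, inner ℝ (-(Y i - (n : ℝ)⁻¹ • S)) (w i) := by
    intro x w
    simp only [inner_sub_right, inner_neg_left, Finset.sum_sub_distrib, Finset.sum_neg_distrib]
    rw [← sum_inner, hY0, inner_zero_left, zero_sub]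
  have htS : 0 < t + ‖S‖ := by
    have : 0 < t := lt_of_lt_of_le (by
      have := Real.log_nonneg (x := n) (by exact_mod_cast hn.le); positivity) ht
    positivity
  -- Weak duality: the `uᵢ` minimize the value for the corrected duals, and any feasible solution of
  -- radius `r` gives at most `r` times the sum of their norms.
  have h1 : ∑ i, inner ℝ (Y i - (n : ℝ)⁻¹ • S) (c - u i) ≤ optRadius Ω * (t + ‖S‖) := by
    rw [← div_le_iff₀ htS]
    refine le_optRadius hne fun z v r hf => ?_
    rw [div_le_iff₀ htS, hshift]
    have hr := hf.nonneg hn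
    calc _ ≤ ∑ i, inner ℝ (-(Y i - (n : ℝ)⁻¹ • S)) (v i) :=
          Finset.sum_le_sum fun i _ => hmin i _ (hf.2 i)
      _ = ∑ i, inner ℝ (Y i - (n : ℝ)⁻¹ • S) (z - v i) := (hshift z v).symm
      _ ≤ ∑ i, ‖Y i - (n : ℝ)⁻¹ • S‖ * r := by
          refine Finset.sum_le_sum fun i _ => (real_inner_le_norm _ _).trans ?_
          gcongr
          exact hf.1 i
      _ ≤ _ := by rw [← Finset.sum_mul, mul_comm r]; gcongr
  have h2 : A - B - ‖S‖ * D ≤ ∑ i, inner ℝ (Y i - (n : ℝ)⁻¹ • S) (c - u i) := by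
    have := hAB u hu
    have h3 : ∑ i, inner ℝ ((n : ℝ)⁻¹ • S) (c - u i) ≤ ‖S‖ * D := by
      calc _ ≤ ∑ _i : Fin n, (n : ℝ)⁻¹ * ‖S‖ * D := by
            refine Finset.sum_le_sum fun i _ => (real_inner_le_norm _ _).trans ?_
            rw [norm_smul, Real.norm_of_nonneg (by positivity), norm_sub_rev]
            gcongr
            exact huD i
        _ = _ := by
            rw [Finset.sum_const, Finset.card_univ, Fintype.card_fin, nsmul_eq_mul]
            field_simp
    simp only [inner_sub_left, Finset.sum_sub_distrib]
    linarith
  have h3 : θ * ‖S‖ ≤ smoothNorm (θ • S) := by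
    have := norm_le_smoothNorm (θ • S)
    rwa [norm_smul, Real.norm_of_nonneg hθ.le] at this
  -- The corrections cost `(r* + D)‖S‖ ≤ 2D‖S‖`, which the term `2D * smoothNorm (θ • S)` of the
  -- centre's regret absorbs. This is why the centre moves in a ball of radius `2D`.
  have hA : θ * A ≤ θ * (optRadius Ω * t) + 2 * D + D * θ ^ 2 * t := by
    have h4 : A - B ≤ optRadius Ω * t + 2 * D * ‖S‖ := by nlinarith [norm_nonneg S]
    nlinarith
  have hlog : θ / D * ‖Z - V i‖ ≤ Real.log n + (1 + θ / D * A + 16 * θ ^ 2 * t) := by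
    rw [← Real.log_exp (1 + θ / D * A + 16 * θ ^ 2 * t),
      ← Real.log_mul hn0.ne' (Real.exp_pos _).ne', Real.le_log_iff_exp_le (by positivity)]
    refine le_trans ?_ hpot
    refine le_trans ?_ (Finset.single_le_sum (f := fun i => weight (θ / D) Z V i)
      (fun i _ => (weight_pos _ _ _ i).le) (Finset.mem_univ i))
    refine Real.exp_le_exp.2 (le_trans (le_of_eq ?_) (norm_le_smoothNorm _))
    rw [norm_smul, Real.norm_of_nonneg (by positivity)]
  have ht' : 3 + Real.log n ≤ t * θ ^ 2 := by rwa [div_le_iff₀ (by positivity)] at ht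
  have h5 : θ * ‖Z - V i‖ ≤ D * (Real.log n + 1 + 16 * θ ^ 2 * t) + θ * A := by
    have := mul_le_mul_of_nonneg_left hlog hD.le
    have e1 : D * (θ / D * ‖Z - V i‖) = θ * ‖Z - V i‖ := by field_simp
    have e2 : D * (Real.log n + (1 + θ / D * A + 16 * θ ^ 2 * t)) =
      D * (Real.log n + 1 + 16 * θ ^ 2 * t) + θ * A := by field_simp; ring
    linarith
  -- The constants collect to `D * (3 + log n)`, at most `D * θ² * t` by the choice of `t`; with `16
  -- + 1` from the second-order errors this gives `18`.
  refine le_of_mul_le_mul_left ?_ hθ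
  nlinarith

/-! ### Programs with `for` loops -/

/-- Memory contents. -/
abbrev Mem : Type := ℕ → ℕ → ℕ → ℝ

/-- The state with loop indices `i`, `j` in registers `2`, `3`. -/
def stateAt (n d i j : ℕ) (m : Mem) (k : ℕ) : State where
  reg := fun x => if x = 0 then n else if x = 1 then d else if x = 2 then i
    else if x = 3 then j else 0
  mem := m
  calls := k

/-- Number of steps of a program in which every loop body runs once. -/
def Prog.weight : Prog → ℕ
  | skip => 1
  | setReg _ a => a.cost + 1
  | setCell _ i j a => i.cost + j.cost + a.cost + 1
  | call _ _ => 1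
  | seq p q => p.weight + q.weight
  | branch b p q => b.cost + p.weight + q.weight
  | loop b p => 2 * b.cost + p.weight

/-- The program `p` leads from `s` to `s'` in at most `p.weight * X` steps. -/
def Runs (sub : Subroutine n d) (X : ℝ) (p : Prog) (s s' : State) : Prop :=
  ∃ t : ℕ, Exec sub p s s' t ∧ (t : ℝ) ≤ p.weight * X

variable {sub : Subroutine n d} {X : ℝ} {p q : Prog} {s s' s'' : State}

theorem Runs.mono {X' : ℝ} (h : Runs sub X p s s') (hX : X ≤ X') : Runs sub X' p s s' := by
  obtain ⟨t, ht, hb⟩ := h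
  exact ⟨t, ht, hb.trans (by gcongr)⟩

theorem Runs.seq (h : Runs sub X p s s') (h' : Runs sub X q s' s'') :
    Runs sub X (.seq p q) s s'' := by
  obtain ⟨t, ht, hb⟩ := h
  obtain ⟨t', ht', hb'⟩ := h'
  refine ⟨t + t', ht.seq ht', ?_⟩
  simp only [Prog.weight]
  push_cast
  linarith

theorem Runs.branchTrue {b : Test} (hX : 1 ≤ X) (hb : b.holds s) (h : Runs sub X p s s') :
    Runs sub X (.branch b p q) s s' := by
  obtain ⟨t, ht, hc⟩ := h
  refine ⟨b.cost + t, .branchTrue hb ht, ?_⟩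
  simp only [Prog.weight]
  push_cast
  have h1 : (b.cost : ℝ) ≤ b.cost * X := le_mul_of_one_le_right (by positivity) hX
  have h2 : (0 : ℝ) ≤ q.weight * X := by positivity
  linarith

theorem Runs.branchFalse {b : Test} (hX : 1 ≤ X) (hb : ¬ b.holds s) (h : Runs sub X q s s') :
    Runs sub X (.branch b p q) s s' := by
  obtain ⟨t, ht, hc⟩ := h
  refine ⟨b.cost + t, .branchFalse hb ht, ?_⟩
  simp only [Prog.weight]
  push_cast
  have h1 : (b.cost : ℝ) ≤ b.cost * X := le_mul_of_one_le_right (by positivity) hX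
  have h2 : (0 : ℝ) ≤ p.weight * X := by positivity
  linarith

theorem Runs.skip (hX : 1 ≤ X) : Runs sub X .skip s s :=
  ⟨1, .skip s, by simpa [Prog.weight] using hX⟩

/-- Store `x` in the cell `A[a, b]`. -/
def putCell (m : Mem) (A a b : ℕ) (x : ℝ) : Mem :=
  fun B k l => if B = A ∧ k = a ∧ l = b then x else m B k l

/-- Store `f 0, …, f (e - 1)` at the beginning of the row `A[a]`. -/
def putRow (m : Mem) (A a e : ℕ) (f : ℕ → ℝ) : Mem :=
  fun B k l => if B = A ∧ k = a ∧ l < e then f l else m B k l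

/-- Store `f i j` in `A[i, j]` for `i < e` and `j < d`. -/
def putBlock (m : Mem) (A e d : ℕ) (f : ℕ → ℕ → ℝ) : Mem :=
  fun B k l => if B = A ∧ k < e ∧ l < d then f k l else m B k l

theorem Runs.setCell (hX : 1 ≤ X) {i j k : ℕ} {m : Mem} {A : ℕ} {a b : NExpr} {e : RExpr}
    {r c : ℕ} {x : ℝ} (ha : a.val (stateAt n d i j m k) = r)
    (hb : b.val (stateAt n d i j m k) = c) (he : e.val (stateAt n d i j m k) = x) :
    Runs sub X (.setCell A a b e) (stateAt n d i j m k)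
      (stateAt n d i j (putCell m A r c x) k) := by
  subst ha hb he
  refine ⟨_, .setCell A a b e _, ?_⟩
  exact le_mul_of_one_le_right (by positivity) hX

/-- Run `p` for all values of the column index. -/
def Prog.forCol (p : Prog) : Prog :=
  .seq (.loop (.ltN (.reg 3) (.reg 1)) (.seq p (.setReg 3 (.add (.reg 3) (.const 1)))))
    (.setReg 3 (.const 0))

/-- Run `p` for all values of the row index. -/
def Prog.forRow (p : Prog) : Prog :=
  .seq (.loop (.ltN (.reg 2) (.reg 0)) (.seq p (.setReg 2 (.add (.reg 2) (.const 1)))))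
    (.setReg 2 (.const 0))

theorem stateAt_putReg_three (i j j' : ℕ) (m : Mem) (k : ℕ) :
    (stateAt n d i j m k).putReg 3 j' = stateAt n d i j' m k := by
  simp only [stateAt, State.putReg, State.mk.injEq, and_true]
  funext x
  split_ifs <;> simp_all

theorem stateAt_putReg_two (i j i' : ℕ) (m : Mem) (k : ℕ) :
    (stateAt n d i j m k).putReg 2 i' = stateAt n d i' j m k := by
  simp only [stateAt, State.putReg, State.mk.injEq, and_true]
  funext x
  split_ifs <;> simp_all

/-- The test is evaluated `N + 1 ≤ 2 * N` times, which is why `Prog.weight` counts it twice. A loop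
thus multiplies the time scale `X` by `N`, and the weight stays a constant of the program. -/
theorem Runs.loop {b : Test} {P : ℕ → State → Prop} {N : ℕ} (hN : 1 ≤ N) (hX : 1 ≤ X)
    (hend : ∀ s, P N s → ¬ b.holds s)
    (hstep : ∀ j < N, ∀ s, P j s → b.holds s ∧ ∃ s', Runs sub X p s s' ∧ P (j + 1) s')
    (h0 : P 0 s) : ∃ s', Runs sub (X * N) (.loop b p) s s' ∧ P N s' := by
  have key : ∀ e j s, j + e = N → P j s → ∃ s', ∃ t : ℕ,
      Exec sub (.loop b p) s s' t ∧ P N s' ∧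
        (t : ℝ) ≤ (b.cost + p.weight * X) * e + b.cost := by
    intro e
    induction e with
    | zero =>
      intro j s hj hP
      obtain rfl : j = N := by omega
      exact ⟨s, _, .loopFalse (hend s hP), hP, by simp⟩
    | succ e ih =>
      intro j s hj hP
      obtain ⟨hb, s', ⟨t, ht, hc⟩, hP'⟩ := hstep j (by omega) s hP
      obtain ⟨s'', t', ht', hP'', hc'⟩ := ih (j + 1) s' (by omega) hP'
      refine ⟨s'', _, .loopTrue hb ht ht', hP'', ?_⟩
      push_cast
      linarith
  obtain ⟨s', t, ht, hP, hc⟩ := key N 0 s (by omega) h0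
  refine ⟨s', ⟨t, ht, hc.trans ?_⟩, hP⟩
  simp only [Prog.weight]
  have hN' : (1 : ℝ) ≤ N := by exact_mod_cast hN
  have h1 : (b.cost : ℝ) * N ≤ b.cost * (X * N) := by
    gcongr; exact le_mul_of_one_le_left (by positivity) hX
  have h2 : (b.cost : ℝ) ≤ b.cost * N := le_mul_of_one_le_right (by positivity) hN'
  push_cast
  linarith

theorem Runs.setReg (hX : 1 ≤ X) (x : ℕ) (a : NExpr) (s : State) :
    Runs sub X (.setReg x a) s (s.putReg x (a.val s)) :=
  ⟨_, .setReg x a s, le_mul_of_one_le_right (by positivity) hX⟩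

theorem Runs.forCol (hd : 1 ≤ d) (hX : 1 ≤ X) {i k : ℕ} {m : Mem} {P : ℕ → Mem → Prop}
    (h0 : P 0 m)
    (hstep : ∀ j < d, ∀ m, P j m → ∃ m',
      Runs sub X p (stateAt n d i j m k) (stateAt n d i j m' k) ∧ P (j + 1) m') :
    ∃ m', Runs sub (X * d) p.forCol (stateAt n d i 0 m k) (stateAt n d i 0 m' k) ∧ P d m' := by
  obtain ⟨_, h, m', rfl, hP⟩ := Runs.loop (sub := sub) (X := X)
    (p := .seq p (.setReg 3 (.add (.reg 3) (.const 1)))) (b := .ltN (.reg 3) (.reg 1)) hd hX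
    (s := stateAt n d i 0 m k) (P := fun j s => ∃ m, s = stateAt n d i j m k ∧ P j m)
    (by rintro _ ⟨m, rfl, -⟩; simp [Test.holds, NExpr.val, stateAt])
    (by
      rintro j hj _ ⟨m, rfl, hP⟩
      obtain ⟨m', h, hP'⟩ := hstep j hj m hP
      refine ⟨by simpa [Test.holds, NExpr.val, stateAt] using hj, _, h.seq (.setReg hX _ _ _),
        m', stateAt_putReg_three _ _ _ _ _, hP'⟩)
    ⟨m, rfl, h0⟩
  have hd' : (1 : ℝ) ≤ d := by exact_mod_cast hd
  have h' := h.seq (.setReg (by nlinarith) 3 (.const 0) _)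
  rw [stateAt_putReg_three] at h'
  exact ⟨m', h', hP⟩

theorem Runs.forRow (hn : 1 ≤ n) (hX : 1 ≤ X) {k : ℕ} {m : Mem} {P : ℕ → Mem → Prop}
    (h0 : P 0 m)
    (hstep : ∀ i < n, ∀ m, P i m → ∃ m',
      Runs sub X p (stateAt n d i 0 m k) (stateAt n d i 0 m' k) ∧ P (i + 1) m') :
    ∃ m', Runs sub (X * n) p.forRow (stateAt n d 0 0 m k) (stateAt n d 0 0 m' k) ∧ P n m' := by
  obtain ⟨_, h, m', rfl, hP⟩ := Runs.loop (sub := sub) (X := X)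
    (p := .seq p (.setReg 2 (.add (.reg 2) (.const 1)))) (b := .ltN (.reg 2) (.reg 0)) hn hX
    (s := stateAt n d 0 0 m k) (P := fun i s => ∃ m, s = stateAt n d i 0 m k ∧ P i m)
    (by rintro _ ⟨m, rfl, -⟩; simp [Test.holds, NExpr.val, stateAt])
    (by
      rintro i hi _ ⟨m, rfl, hP⟩
      obtain ⟨m', h, hP'⟩ := hstep i hi m hP
      refine ⟨by simpa [Test.holds, NExpr.val, stateAt] using hi, _, h.seq (.setReg hX _ _ _),
        m', stateAt_putReg_two _ _ _ _ _, hP'⟩)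
    ⟨m, rfl, h0⟩
  have hn' : (1 : ℝ) ≤ n := by exact_mod_cast hn
  have h' := h.seq (.setReg (by nlinarith) 2 (.const 0) _)
  rw [stateAt_putReg_two] at h'
  exact ⟨m', h', hP⟩

/-! ### Loops that fill or sum arrays -/

/-- Fill a row. -/
theorem Runs.fillRow (hd : 1 ≤ d) {i k : ℕ} {m : Mem} {A : ℕ} {a : NExpr} {e : RExpr}
    {r : ℕ} {f : ℕ → ℝ} (ha : ∀ j m, a.val (stateAt n d i j m k) = r)
    -- The expression may read any other array and the cell about to be overwritten, so updates in
    -- place are covered.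
    (he : ∀ j < d, ∀ m', (∀ B k l, B ≠ A → m' B k l = m B k l) → m' A r j = m A r j →
      e.val (stateAt n d i j m' k) = f j) :
    Runs sub d (Prog.setCell A a (.reg 3) e).forCol (stateAt n d i 0 m k)
      (stateAt n d i 0 (putRow m A r d f) k) := by
  obtain ⟨m', h, rfl⟩ := Runs.forCol (sub := sub) (X := 1) (p := .setCell A a (.reg 3) e) hd le_rfl
    (i := i) (k := k) (m := m) (P := fun j m' => m' = putRow m A r j f)
    (by funext B k l; simp [putRow]) (by
      rintro j hj _ rfl
      refine ⟨_, Runs.setCell le_rfl (ha _ _) rfl rfl, ?_⟩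
      rw [he j hj _ (fun B k l hB => by simp [putRow, hB]) (by simp [putRow])]
      funext B k l
      simp only [putCell, putRow, NExpr.val, stateAt]
      simp only [Nat.lt_succ_iff_lt_or_eq]
      by_cases h : l = j <;> simp +contextual [h])
  rwa [one_mul] at h

/-- Fill a block. -/
theorem Runs.fillBlock (hn : 1 ≤ n) (hd : 1 ≤ d) {k : ℕ} {m : Mem} {A : ℕ} {e : RExpr}
    {f : ℕ → ℕ → ℝ}
    (he : ∀ i < n, ∀ j < d, ∀ m', (∀ B k l, B ≠ A → m' B k l = m B k l) → m' A i j = m A i j →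
      e.val (stateAt n d i j m' k) = f i j) :
    Runs sub (d * n) (Prog.setCell A (.reg 2) (.reg 3) e).forCol.forRow (stateAt n d 0 0 m k)
      (stateAt n d 0 0 (putBlock m A n d f) k) := by
  obtain ⟨m', h, rfl⟩ := Runs.forRow (sub := sub) (X := d)
    (p := (Prog.setCell A (.reg 2) (.reg 3) e).forCol) hn (by exact_mod_cast hd)
    (k := k) (m := m) (P := fun i m' => m' = putBlock m A i d f)
    (by funext B k l; simp [putBlock]) (by
      rintro i hi _ rfl
      refine ⟨_, Runs.fillRow (r := i) (f := f i) hd (fun _ _ => rfl) ?_, ?_⟩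
      · intro j hj m' h1 h2
        refine he i hi j hj m' (fun B k l hB => ?_) ?_
        · rw [h1 B k l hB]; simp [putBlock, hB]
        · rw [h2]; simp [putBlock]
      · funext B k l
        simp only [putRow, putBlock]
        simp only [Nat.lt_succ_iff_lt_or_eq]
        by_cases h : k = i <;> simp +contextual [h])
  exact h

/-- Add up a row of values in a cell. -/
theorem Runs.accumulate (hd : 1 ≤ d) {i k : ℕ} {m : Mem} {A : ℕ} {a : NExpr} {e : RExpr}
    {r : ℕ} {f : ℕ → ℝ} (ha : ∀ j m, a.val (stateAt n d i j m k) = r)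
    (he : ∀ j < d, ∀ x, e.val (stateAt n d i j (putCell m A r 0 x) k) = f j) :
    Runs sub d (Prog.setCell A a (.const 0) (.add (.cell A a (.const 0)) e)).forCol
      (stateAt n d i 0 m k)
      (stateAt n d i 0 (putCell m A r 0 (m A r 0 + ∑ j ∈ Finset.range d, f j)) k) := by
  obtain ⟨m', h, rfl⟩ := Runs.forCol (sub := sub) (X := 1)
    (p := .setCell A a (.const 0) (.add (.cell A a (.const 0)) e)) hd le_rfl
    (i := i) (k := k) (m := m)
    (P := fun j m' => m' = putCell m A r 0 (m A r 0 + ∑ j ∈ Finset.range j, f j))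
    (by funext B k l; simp only [putCell]; split_ifs with h <;> simp_all) (by
      rintro j hj _ rfl
      refine ⟨_, Runs.setCell (x := m A r 0 + ∑ j ∈ Finset.range (j + 1), f j) le_rfl
        (ha _ _) rfl ?_, ?_⟩
      · simp only [RExpr.val, he j hj, ha, Finset.sum_range_succ]
        simp [NExpr.val, stateAt, putCell, add_assoc]
      · funext B k l
        simp only [putCell, NExpr.val]
        split_ifs <;> rfl)
  rwa [one_mul] at h

/-! ### Vectors in memory -/

/-- The vector in row `i` of the array `A`. -/
def rowAt (d : ℕ) (m : Mem) (A i : ℕ) : E d := WithLp.toLp 2 fun j : Fin d => m A i j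

/-- The vectors in the rows of the array `A`. -/
def rowsAt (n d : ℕ) (m : Mem) (A : ℕ) : Fin n → E d := fun i => rowAt d m A i

@[simp] theorem rowAt_apply (m : Mem) (A i : ℕ) (j : Fin d) : rowAt d m A i j = m A i j := rfl

theorem rowAt_congr {m m' : Mem} {A : ℕ} (h : m' A = m A) (i : ℕ) :
    rowAt d m' A i = rowAt d m A i := by unfold rowAt; rw [h]

theorem rowsAt_congr {m m' : Mem} {A : ℕ} (h : m' A = m A) :
    rowsAt n d m' A = rowsAt n d m A := funext fun i => rowAt_congr h i

theorem norm_sq_eq_sum_range {x : E d} {f : ℕ → ℝ} (h : ∀ j : Fin d, x j = f j) :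
    ‖x‖ ^ 2 = ∑ j ∈ Finset.range d, f j * f j := by
  rw [EuclideanSpace.real_norm_sq_eq, Finset.sum_range]
  simp only [h, sq]

/-- The scalar `A[0, 0]`. -/
def RExpr.scalar (A : ℕ) : RExpr := .cell A (.const 0) (.const 0)

/-- The entry of the row `A[0]` in the current column. -/
def RExpr.col (A : ℕ) : RExpr := .cell A (.const 0) (.reg 3)

/-- The current entry of the array `A`. -/
def RExpr.entry (A : ℕ) : RExpr := .cell A (.reg 2) (.reg 3)

/-- The first entry of the current row of the array `A`. -/
def RExpr.head (A : ℕ) : RExpr := .cell A (.reg 2) (.const 0)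

/-- Set the scalar `A[0, 0]`. -/
def Prog.setScalar (A : ℕ) (e : RExpr) : Prog := .setCell A (.const 0) (.const 0) e

section
variable (i j k : ℕ) (m : Mem) (A : ℕ) (a b : RExpr)

@[simp] theorem RExpr.val_scalar : (scalar A).val (stateAt n d i j m k) = m A 0 0 := rfl
@[simp] theorem RExpr.val_col : (col A).val (stateAt n d i j m k) = m A 0 j := rfl
@[simp] theorem RExpr.val_entry : (entry A).val (stateAt n d i j m k) = m A i j := rfl
@[simp] theorem NExpr.val_rowCount : (reg 0).val (stateAt n d i j m k) = n := rfl
@[simp] theorem RExpr.val_head : (head A).val (stateAt n d i j m k) = m A i 0 := rfl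

end

attribute [simp] RExpr.val

theorem Runs.setScalar {X : ℝ} (hX : 1 ≤ X) {i j k : ℕ} {m : Mem} {A : ℕ} {e : RExpr} {x : ℝ}
    (he : e.val (stateAt n d i j m k) = x) :
    Runs sub X (.setScalar A e) (stateAt n d i j m k)
      (stateAt n d i j (putCell m A 0 0 x) k) :=
  .setCell hX rfl rfl he

/-! ### Distances, weights and centres in memory -/

/-- Increase the scalar `X[0, 0]` to the largest squared distance of a row of `A` from the first
row of `B`. -/
def Prog.maxDist (A B X : ℕ) : Prog :=
  .forRow <| .seq (.setScalar 11 (.const 0)) <|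
    .seq (.forCol (.setCell 11 (.const 0) (.const 0) (.add (.cell 11 (.const 0) (.const 0))
      (.mul (.sub (.entry A) (.col B)) (.sub (.entry A) (.col B)))))) <|
    .branch (.ltR (.scalar X) (.scalar 11)) (.setScalar X (.scalar 11)) .skip

/-- The last alternative records that a new maximum is attained by an actual row. This later
certifies that a guess `D` that was exceeded lies below the diameter. -/
theorem Runs.maxDist (hn : 1 ≤ n) (hd : 1 ≤ d) {A B X : ℕ} (hA : A ≠ 11) (hB : B ≠ 11)
    (hX : X ≠ 11) (hAX : A ≠ X) (hBX : B ≠ X) (m : Mem) (k : ℕ) :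
    ∃ m', Runs sub (d * n) (.maxDist A B X) (stateAt n d 0 0 m k) (stateAt n d 0 0 m' k) ∧
      (∀ C, C ≠ 11 → C ≠ X → m' C = m C) ∧ m X 0 0 ≤ m' X 0 0 ∧
      (∀ i : Fin n, ‖rowsAt n d m A i - rowAt d m B 0‖ ^ 2 ≤ m' X 0 0) ∧
      (m' X 0 0 = m X 0 0 ∨ ∃ i, m' X 0 0 = ‖rowsAt n d m A i - rowAt d m B 0‖ ^ 2) := by
  have hd' : (1 : ℝ) ≤ d := by exact_mod_cast hd
  obtain ⟨m', h, h1, h2, h3, h4⟩ := Runs.forRow (sub := sub) (m := m) (k := k) hn hd'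
    (p := .seq (.setScalar 11 (.const 0)) <|
    .seq (.forCol (.setCell 11 (.const 0) (.const 0) (.add (.cell 11 (.const 0) (.const 0))
      (.mul (.sub (.entry A) (.col B)) (.sub (.entry A) (.col B)))))) <|
    .branch (.ltR (.scalar X) (.scalar 11)) (.setScalar X (.scalar 11)) .skip)
    (P := fun i₀ m' => (∀ C, C ≠ 11 → C ≠ X → m' C = m C) ∧ m X 0 0 ≤ m' X 0 0 ∧
      (∀ i : Fin n, (i : ℕ) < i₀ → ‖rowsAt n d m A i - rowAt d m B 0‖ ^ 2 ≤ m' X 0 0) ∧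
      (m' X 0 0 = m X 0 0 ∨ ∃ i, m' X 0 0 = ‖rowsAt n d m A i - rowAt d m B 0‖ ^ 2))
    ⟨fun _ _ _ => rfl, le_rfl, fun _ h => absurd h (Nat.not_lt_zero _), .inl rfl⟩
    (by
      rintro i hi m₁ ⟨hf, hle, hall, hatt⟩
      set i' : Fin n := ⟨i, hi⟩
      set x := ‖rowsAt n d m A i' - rowAt d m B 0‖ ^ 2 with hx
      have hx' : x = ∑ j ∈ Finset.range d, (m A i j - m B 0 j) * (m A i j - m B 0 j) :=
        norm_sq_eq_sum_range fun j => rfl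
      have r1 := Runs.setScalar (sub := sub) (X := d) (i := i) (j := 0) (k := k) (m := m₁)
        (A := 11) (e := .const 0) (x := 0) hd' (by simp)
      have r2 := Runs.accumulate (sub := sub) (i := i) (k := k) (m := putCell m₁ 11 0 0 0)
        (A := 11) (a := .const 0) (r := 0)
        (e := .mul (.sub (.entry A) (.col B)) (.sub (.entry A) (.col B)))
        (f := fun j => (m A i j - m B 0 j) * (m A i j - m B 0 j)) hd (fun _ _ => rfl)
        (fun j _ y => by simp [putCell, hA, hB, hf A hA hAX, hf B hB hBX])
      rw [← hx'] at r2
      set m₂ := putCell (putCell m₁ 11 0 0 0) 11 0 0 (putCell m₁ 11 0 0 0 11 0 0 + x) with hm₂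
      have e11 : m₂ 11 0 0 = x := by simp [hm₂, putCell]
      have eC : ∀ C, C ≠ 11 → m₂ C = m₁ C := fun C hC => by
        funext a b; simp [hm₂, putCell, hC]
      by_cases hlt : m₁ X 0 0 < x
      · refine ⟨putCell m₂ X 0 0 x, r1.seq (r2.seq (.branchTrue hd' ?_
          (.setScalar hd' (by simp [e11])))), ?_, ?_, ?_, ?_⟩
        · simpa [Test.holds, e11, eC X hX] using hlt
        · intro C h1 h2
          funext a b
          simp [putCell, h2, eC C h1, hf C h1 h2]
        · simpa [putCell] using hle.trans hlt.le
        · intro i'' hi''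
          simp only [putCell, and_self, if_true]
          rcases Nat.lt_succ_iff_lt_or_eq.1 hi'' with h | h
          · exact (hall i'' h).trans hlt.le
          · obtain rfl : i'' = i' := Fin.ext h
            exact le_rfl
        · exact .inr ⟨i', by simp [putCell, hx]⟩
      · refine ⟨m₂, r1.seq (r2.seq (.branchFalse hd' ?_ (.skip hd'))), ?_, ?_, ?_, ?_⟩
        · simpa [Test.holds, e11, eC X hX] using hlt
        · intro C h1 h2
          rw [eC C h1, hf C h1 h2]
        · rwa [eC X hX]
        · intro i'' hi''
          rw [eC X hX]
          rcases Nat.lt_succ_iff_lt_or_eq.1 hi'' with h | h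
          · exact hall i'' h
          · obtain rfl : i'' = i' := Fin.ext h
            exact not_lt.1 hlt
        · rwa [eC X hX])
  exact ⟨m', h, h1, h2, fun i => h3 i i.2, h4⟩

/-- Compute the smoothed norms (array `9`) and the sum of the weights (scalar `10`). -/
def Prog.weights : Prog :=
  .seq (.setScalar 10 (.const 0)) <| .forRow <|
    -- The accumulation starts at `1`, the constant under the root of the smoothed norm.
    .seq (.setCell 9 (.reg 2) (.const 0) (.const 1)) <|
    .seq (.forCol (.setCell 9 (.reg 2) (.const 0) (.add (.cell 9 (.reg 2) (.const 0))
      (.mul (.mul (.div (.scalar 16) (.scalar 13)) (.sub (.col 1) (.entry 2)))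
        (.mul (.div (.scalar 16) (.scalar 13)) (.sub (.col 1) (.entry 2))))))) <|
    .seq (.setCell 9 (.reg 2) (.const 0) (.sqrt (.head 9))) <|
    .setScalar 10 (.add (.scalar 10) (.exp (.head 9)))

theorem Runs.weights (hn : 1 ≤ n) (hd : 1 ≤ d) (m : Mem) (k : ℕ) :
    ∃ m', Runs sub (d * n) .weights (stateAt n d 0 0 m k) (stateAt n d 0 0 m' k) ∧
      (∀ C, C ≠ 9 → C ≠ 10 → m' C = m C) ∧
      (∀ i : Fin n, m' 9 i 0 =
        smoothNorm ((m 16 0 0 / m 13 0 0) • (rowAt d m 1 0 - rowsAt n d m 2 i))) ∧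
      m' 10 0 0 = ∑ i, weight (m 16 0 0 / m 13 0 0) (rowAt d m 1 0) (rowsAt n d m 2) i := by
  have hd' : (1 : ℝ) ≤ d := by exact_mod_cast hd
  have hn' : (1 : ℝ) ≤ n := by exact_mod_cast hn
  set η := m 16 0 0 / m 13 0 0 with hη
  let Q : ℕ → ℝ := fun i => smoothNorm (η • (rowAt d m 1 0 - rowAt d m 2 i))
  obtain ⟨m', h, h1, h2, h3⟩ := Runs.forRow (sub := sub) (m := putCell m 10 0 0 0) (k := k) hn hd'
    (p := .seq (.setCell 9 (.reg 2) (.const 0) (.const 1)) <|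
    .seq (.forCol (.setCell 9 (.reg 2) (.const 0) (.add (.cell 9 (.reg 2) (.const 0))
      (.mul (.mul (.div (.scalar 16) (.scalar 13)) (.sub (.col 1) (.entry 2)))
        (.mul (.div (.scalar 16) (.scalar 13)) (.sub (.col 1) (.entry 2))))))) <|
    .seq (.setCell 9 (.reg 2) (.const 0) (.sqrt (.head 9))) <|
    .setScalar 10 (.add (.scalar 10) (.exp (.head 9))))
    (P := fun i₀ m' => (∀ C, C ≠ 9 → C ≠ 10 → m' C = m C) ∧
      (∀ i < i₀, m' 9 i 0 = Q i) ∧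
      m' 10 0 0 = ∑ i ∈ Finset.range i₀, Real.exp (Q i))
    ⟨fun C _ hC => by funext a b; simp [putCell, hC], by simp, by simp [putCell]⟩
    (by
      rintro i hi m₁ ⟨hf, hq, hW⟩
      set x := ‖η • (rowAt d m 1 0 - rowAt d m 2 i)‖ ^ 2 with hx
      have hx' : x = ∑ j ∈ Finset.range d,
          (η * (m 1 0 j - m 2 i j)) * (η * (m 1 0 j - m 2 i j)) :=
        norm_sq_eq_sum_range fun j => rfl
      have hQ : Q i = √(1 + x) := rfl
      have r1 := Runs.setCell (sub := sub) (X := d) (i := i) (j := 0) (k := k) (m := m₁)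
        (A := 9) (a := .reg 2) (b := .const 0) (e := .const 1) (x := 1) hd' rfl rfl (by simp)
      have r2 := Runs.accumulate (sub := sub) (i := i) (k := k) (m := putCell m₁ 9 i 0 1)
        (A := 9) (a := .reg 2) (r := i)
        (e := .mul (.mul (.div (.scalar 16) (.scalar 13)) (.sub (.col 1) (.entry 2)))
          (.mul (.div (.scalar 16) (.scalar 13)) (.sub (.col 1) (.entry 2))))
        (f := fun j => (η * (m 1 0 j - m 2 i j)) * (η * (m 1 0 j - m 2 i j))) hd
        (fun _ _ => rfl)
        (fun j _ y => by simp [putCell, hf, hη])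
      rw [← hx'] at r2
      set m₂ := putCell (putCell m₁ 9 i 0 1) 9 i 0 (putCell m₁ 9 i 0 1 9 i 0 + x) with hm₂
      have e9 : m₂ 9 i 0 = 1 + x := by simp [hm₂, putCell]
      have r3 := Runs.setCell (sub := sub) (X := d) (i := i) (j := 0) (k := k) (m := m₂)
        (A := 9) (a := .reg 2) (b := .const 0) (e := .sqrt (.head 9)) (x := Q i) hd' rfl rfl
        (by simp [e9, hQ])
      have r4 := Runs.setScalar (sub := sub) (X := d) (i := i) (j := 0) (k := k)
        (m := putCell m₂ 9 i 0 (Q i)) (A := 10) (e := .add (.scalar 10) (.exp (.head 9)))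
        (x := m₁ 10 0 0 + Real.exp (Q i)) hd' (by simp [putCell, hm₂])
      refine ⟨_, r1.seq (r2.seq (r3.seq r4)), ?_, ?_, ?_⟩
      · intro C h1 h2
        funext a b
        simp [putCell, hm₂, h1, h2, hf C h1 h2]
      · intro i₁ hi₁
        by_cases h : i₁ = i
        · simp [putCell, h]
        · simp only [putCell, hm₂, h]
          simp [hq i₁ (by omega)]
      · simp [putCell, hW, Finset.sum_range_succ])
  refine ⟨m', (Runs.setScalar ?_ (by simp)).seq h, h1, fun i => h2 i i.2, ?_⟩
  · nlinarith
  · rw [h3, Finset.sum_range]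
    rfl

/-- Move the point in array `1` by the next centre. -/
def Prog.moveCentre : Prog :=
  .seq (.setScalar 11 (.const 1)) <|
  .seq (.forCol (.setCell 11 (.const 0) (.const 0) (.add (.cell 11 (.const 0) (.const 0))
    (.mul (.mul (.scalar 16) (.col 7)) (.mul (.scalar 16) (.col 7)))))) <|
  .forCol (.setCell 1 (.const 0) (.reg 3) (.add (.col 1) (.sub (.col 8)
    (.mul (.div (.mul (.const 2) (.scalar 13)) (.sqrt (.scalar 11)))
      (.mul (.scalar 16) (.col 7))))))

theorem Runs.moveCentre (hd : 1 ≤ d) (m : Mem) (k : ℕ) :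
    ∃ m', Runs sub d .moveCentre (stateAt n d 0 0 m k) (stateAt n d 0 0 m' k) ∧
      (∀ C, C ≠ 11 → C ≠ 1 → m' C = m C) ∧
      rowAt d m' 1 0 = rowAt d m 1 0 +
        nextCentre (m 13 0 0) (m 16 0 0) (rowAt d m 8 0) (rowAt d m 7 0) := by
  have hd' : (1 : ℝ) ≤ d := by exact_mod_cast hd
  set x := ‖m 16 0 0 • rowAt d m 7 0‖ ^ 2 with hx
  have hx' : x = ∑ j ∈ Finset.range d, (m 16 0 0 * m 7 0 j) * (m 16 0 0 * m 7 0 j) :=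
    norm_sq_eq_sum_range fun j => rfl
  have r1 := Runs.setScalar (sub := sub) (X := d) (i := 0) (j := 0) (k := k) (m := m)
    (A := 11) (e := .const 1) (x := 1) hd' (by simp)
  have r2 := Runs.accumulate (sub := sub) (i := 0) (k := k) (m := putCell m 11 0 0 1)
    (A := 11) (a := .const 0) (r := 0)
    (e := .mul (.mul (.scalar 16) (.col 7)) (.mul (.scalar 16) (.col 7)))
    (f := fun j => (m 16 0 0 * m 7 0 j) * (m 16 0 0 * m 7 0 j)) hd (fun _ _ => rfl)
    (fun j _ y => by simp [putCell])
  rw [← hx'] at r2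
  have r3 := Runs.fillRow (sub := sub) (i := 0) (k := k)
    (m := putCell (putCell m 11 0 0 1) 11 0 0 (putCell m 11 0 0 1 11 0 0 + x)) (A := 1)
    (a := .const 0) (r := 0) (e := .add (.col 1) (.sub (.col 8)
    (.mul (.div (.mul (.const 2) (.scalar 13)) (.sqrt (.scalar 11)))
      (.mul (.scalar 16) (.col 7)))))
    (f := fun j => m 1 0 j + (m 8 0 j - 2 * m 13 0 0 / √(1 + x) * (m 16 0 0 * m 7 0 j)))
    hd (fun _ _ => rfl) (fun j _ m' h1 h2 => by simp [putCell, h1, h2])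
  refine ⟨_, r1.seq (r2.seq r3), ?_, ?_⟩
  · intro C h1 h2
    funext a b
    simp [putRow, putCell, h1, h2]
  · ext j
    simp [putRow, nextCentre, smoothNorm, hx]

/-- Call the subroutine with the array `4`; the answer goes to the array `5`. -/
theorem Runs.call {X : ℝ} (hX : ∀ k h, (sub.steps k h : ℝ) + 1 ≤ X) (m : Mem) (k : ℕ) :
    ∃ m', Runs sub X (.call 4 5) (stateAt n d 0 0 m k) (stateAt n d 0 0 m' (k + 1)) ∧
      (∀ C, C ≠ 5 → m' C = m C) ∧ rowsAt n d m' 5 = sub.answer k (rowsAt n d m 4) := by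
  refine ⟨_, ⟨_, .call 4 5 _, ?_⟩, ?_, ?_⟩
  · simpa [Prog.weight] using hX _ _
  · intro C hC
    funext a b
    simp [State.putRows, stateAt, hC]
  · funext i
    ext j
    simp [rowsAt, rowAt, State.putRows]
    rfl

/-! ### A phase of the algorithm

Arrays: `1` sum of the centres, `2` sums of the answers, `3` radius, `4` and `5` argument and answer
of the subroutine, `6` sums of the dual vectors, `7` sum of all dual vectors, `8` reference point,
`9` smoothed norms, `10` sum of the weights, `11` auxiliary, `12` largest squared distance of an
answer from the reference point, `13` guess `D` for the diameter, `14` upper bound `ρ` for the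
optimal radius, `15` accuracy, `16` step size `θ`, `17` number of rounds done, `18` number of rounds
required, `19` termination flag, `20` largest squared distance from the centre. -/

theorem rowsAt_putBlock (m : Mem) (A : ℕ) (f : ℕ → ℕ → ℝ) :
    rowsAt n d (putBlock m A n d f) A = fun i : Fin n => WithLp.toLp 2 fun j : Fin d => f i j := by
  funext i
  ext j
  simp [rowsAt, putBlock]

theorem putBlock_of_ne {m : Mem} {A C : ℕ} {f : ℕ → ℕ → ℝ} (h : C ≠ A) :
    putBlock m A n d f C = m C := by
  funext a b
  simp [putBlock, h]

theorem rowAt_putRow (m : Mem) (A r : ℕ) (f : ℕ → ℝ) :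
    rowAt d (putRow m A r d f) A r = WithLp.toLp 2 fun j : Fin d => f j := by
  ext j
  simp [putRow]

theorem putRow_of_ne {m : Mem} {A C r : ℕ} {f : ℕ → ℝ} (h : C ≠ A) :
    putRow m A r d f C = m C := by
  funext a b
  simp [putRow, h]

theorem putCell_of_ne {m : Mem} {A C : ℕ} {a b : ℕ} {x : ℝ} (h : C ≠ A) :
    putCell m A a b x C = m C := by
  funext k l
  simp [putCell, h]

theorem putCell_self {m : Mem} {A : ℕ} {a b : ℕ} {x : ℝ} : putCell m A a b x A a b = x := by
  simp [putCell]

/-- Subtract all rows of `B` from the first row of `A`. -/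
def Prog.subRows (A B : ℕ) : Prog :=
  .forRow <| .forCol <| .setCell A (.const 0) (.reg 3) (.sub (.col A) (.entry B))

theorem Runs.subRows (hn : 1 ≤ n) (hd : 1 ≤ d) {A B : ℕ} (hAB : B ≠ A) (m : Mem) (k : ℕ) :
    ∃ m', Runs sub (d * n) (.subRows A B) (stateAt n d 0 0 m k) (stateAt n d 0 0 m' k) ∧
      (∀ C, C ≠ A → m' C = m C) ∧ rowAt d m' A 0 = rowAt d m A 0 - ∑ i, rowsAt n d m B i := by
  have hd' : (1 : ℝ) ≤ d := by exact_mod_cast hd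
  obtain ⟨m', h, h1, h2⟩ := Runs.forRow (sub := sub) (m := m) (k := k) hn hd'
    (p := .forCol <| .setCell A (.const 0) (.reg 3) (.sub (.col A) (.entry B)))
    (P := fun i₀ m' => (∀ C, C ≠ A → m' C = m C) ∧
      rowAt d m' A 0 = rowAt d m A 0 - ∑ i ∈ Finset.range i₀, rowAt d m B i)
    ⟨fun _ _ => rfl, by simp⟩
    (by
      rintro i hi m₁ ⟨hf, hS⟩
      refine ⟨_, Runs.fillRow (r := 0) (f := fun j => m₁ A 0 j - m B i j) hd (fun _ _ => rfl)
        (fun j _ m' h1 h2 => by simp [h1, h2, hAB, hf]), fun C hC => ?_, ?_⟩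
      · rw [putRow_of_ne hC, hf C hC]
      · rw [rowAt_putRow, Finset.sum_range_succ, ← sub_sub, ← hS]
        rfl)
  refine ⟨m', h, h1, ?_⟩
  rw [h2, Finset.sum_range]
  rfl

/-- One round. -/
def Prog.round : Prog :=
  .seq .weights <|
  .seq (.forRow <| .forCol <| .setCell 4 (.reg 2) (.reg 3)
    (.mul (.div (.exp (.head 9)) (.mul (.scalar 10) (.head 9)))
      (.mul (.div (.scalar 16) (.scalar 13)) (.sub (.entry 2) (.col 1))))) <|
  .seq (.call 4 5) <|
  .seq .moveCentre <|
  .seq (.forRow <| .forCol <| .setCell 2 (.reg 2) (.reg 3) (.add (.entry 2) (.entry 5))) <|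
  .seq (.forRow <| .forCol <| .setCell 6 (.reg 2) (.reg 3) (.sub (.entry 6) (.entry 4))) <|
  .seq (.subRows 7 4) <|
  .seq (.maxDist 5 8 12) <|
  .setScalar 17 (.add (.scalar 17) (.const 1))

/-- The subroutine minimizes, so array `4` holds the negated dual vectors; arrays `6` and `7` are
therefore updated by subtraction. -/
theorem Runs.round (hn : 1 ≤ n) (hd : 1 ≤ d) {X : ℝ} (hX : (d : ℝ) * n ≤ X)
    (hsub : ∀ k h, (sub.steps k h : ℝ) + 1 ≤ X) (m : Mem) (k : ℕ) {y v : Fin n → E d}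
    (hy : y = dualVec (m 16 0 0 / m 13 0 0) (rowAt d m 1 0) (rowsAt n d m 2))
    (hv : v = sub.answer k fun i => -y i) :
    ∃ m', Runs sub X .round (stateAt n d 0 0 m k) (stateAt n d 0 0 m' (k + 1)) ∧
      (∀ C, (C = 0 ∨ C = 8 ∨ (13 ≤ C ∧ C ≤ 16) ∨ 18 ≤ C) → m' C = m C) ∧
      rowAt d m' 1 0 = rowAt d m 1 0 +
        nextCentre (m 13 0 0) (m 16 0 0) (rowAt d m 8 0) (rowAt d m 7 0) ∧
      rowAt d m' 7 0 = rowAt d m 7 0 + ∑ i, y i ∧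
      rowsAt n d m' 2 = rowsAt n d m 2 + v ∧ rowsAt n d m' 6 = rowsAt n d m 6 + y ∧
      m' 17 0 0 = m 17 0 0 + 1 ∧ m 12 0 0 ≤ m' 12 0 0 ∧
      (∀ i, ‖v i - rowAt d m 8 0‖ ^ 2 ≤ m' 12 0 0) ∧
      (m' 12 0 0 = m 12 0 0 ∨ ∃ i, m' 12 0 0 = ‖v i - rowAt d m 8 0‖ ^ 2) := by
  have hd' : (1 : ℝ) ≤ d := by exact_mod_cast hd
  have hn' : (1 : ℝ) ≤ n := by exact_mod_cast hn
  have hdX : (d : ℝ) ≤ X := by nlinarith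
  have hX1 : 1 ≤ X := hd'.trans hdX
  obtain ⟨m₁, r1, f1, q1, w1⟩ := Runs.weights (sub := sub) hn hd m k
  have r2 := Runs.fillBlock (sub := sub) (k := k) (m := m₁) (A := 4)
    (e := .mul (.div (.exp (.head 9)) (.mul (.scalar 10) (.head 9)))
      (.mul (.div (.scalar 16) (.scalar 13)) (.sub (.entry 2) (.col 1))))
    (f := fun i j => Real.exp (m₁ 9 i 0) / (m₁ 10 0 0 * m₁ 9 i 0) *
      (m 16 0 0 / m 13 0 0 * (m 2 i j - m 1 0 j))) hn hd
    (fun i _ j _ m' h _ => by simp [h, f1])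
  set m₂ := putBlock m₁ 4 n d fun i j => Real.exp (m₁ 9 i 0) / (m₁ 10 0 0 * m₁ 9 i 0) *
      (m 16 0 0 / m 13 0 0 * (m 2 i j - m 1 0 j)) with hm₂
  have f2 : ∀ C, C ≠ 4 → m₂ C = m₁ C := fun C hC => putBlock_of_ne hC
  have h4 : rowsAt n d m₂ 4 = fun i => -y i := by
    rw [hm₂, rowsAt_putBlock, hy]
    funext i
    ext j
    simp only [q1 i, w1, dualVec, weight, PiLp.neg_apply, PiLp.smul_apply, PiLp.sub_apply,
      smul_eq_mul, rowAt_apply, rowsAt]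
    ring
  obtain ⟨m₃, r3, f3, h5⟩ := Runs.call hsub m₂ k
  rw [h4, ← hv] at h5
  obtain ⟨m₄, r4, f4, h1⟩ := Runs.moveCentre (n := n) (sub := sub) hd m₃ (k + 1)
  have r5 := Runs.fillBlock (sub := sub) (k := k + 1) (m := m₄) (A := 2)
    (e := .add (.entry 2) (.entry 5)) (f := fun i j => m₄ 2 i j + m₄ 5 i j) hn hd
    (fun i _ j _ m' h h' => by simp [h, h'])
  set m₅ := putBlock m₄ 2 n d fun i j => m₄ 2 i j + m₄ 5 i j with hm₅
  have f5 : ∀ C, C ≠ 2 → m₅ C = m₄ C := fun C hC => putBlock_of_ne hC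
  have h2 : rowsAt n d m₅ 2 = rowsAt n d m₄ 2 + rowsAt n d m₄ 5 := by
    rw [hm₅, rowsAt_putBlock]
    rfl
  have r6 := Runs.fillBlock (sub := sub) (k := k + 1) (m := m₅) (A := 6)
    (e := .sub (.entry 6) (.entry 4)) (f := fun i j => m₅ 6 i j - m₅ 4 i j) hn hd
    (fun i _ j _ m' h h' => by simp [h, h'])
  set m₆ := putBlock m₅ 6 n d fun i j => m₅ 6 i j - m₅ 4 i j with hm₆
  have f6 : ∀ C, C ≠ 6 → m₆ C = m₅ C := fun C hC => putBlock_of_ne hC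
  have h6 : rowsAt n d m₆ 6 = rowsAt n d m₅ 6 - rowsAt n d m₅ 4 := by
    rw [hm₆, rowsAt_putBlock]
    rfl
  obtain ⟨m₇, r7, f7, h7⟩ := Runs.subRows (sub := sub) hn hd (A := 7) (B := 4) (by decide)
    m₆ (k + 1)
  obtain ⟨m₈, r8, f8, hle, hall, hatt⟩ := Runs.maxDist (sub := sub) hn hd (A := 5) (B := 8)
    (X := 12) (by decide) (by decide) (by decide) (by decide) (by decide) m₇ (k + 1)
  have r9 := Runs.setScalar (sub := sub) (i := 0) (j := 0) (k := k + 1) (m := m₈) (A := 17)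
    (e := .add (.scalar 17) (.const 1)) (x := m 17 0 0 + 1) hX1 (by
      simp [f8, f7, f6, f5, f4, f3, f2, f1])
  have e4 : m₆ 4 = m₂ 4 := by simp [f6, f5, f4, f3]
  have e5 : m₇ 5 = m₃ 5 := by simp [f7, f6, f5, f4]
  have e8 : m₇ 8 = m 8 := by simp [f7, f6, f5, f4, f3, f2, f1]
  have e12 : m₇ 12 = m 12 := by simp [f7, f6, f5, f4, f3, f2, f1]
  rw [rowsAt_congr e5, h5, rowAt_congr e8] at hall hatt
  rw [e12] at hle hatt
  refine ⟨putCell m₈ 17 0 0 (m 17 0 0 + 1), (r1.mono hX).seq <| (r2.mono hX).seq <| r3.seq <|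
    (r4.mono hdX).seq <| (r5.mono hX).seq <| (r6.mono hX).seq <| (r7.mono hX).seq <|
    (r8.mono hX).seq r9, ?_, ?_, ?_, ?_, ?_, putCell_self, ?_⟩
  · intro C hC
    rw [putCell_of_ne (by omega), f8 C (by omega) (by omega), f7 C (by omega), f6 C (by omega),
      f5 C (by omega), f4 C (by omega) (by omega), f3 C (by omega), f2 C (by omega),
      f1 C (by omega) (by omega)]
  · have e1 : putCell m₈ 17 0 0 (m 17 0 0 + 1) 1 = m₄ 1 := by
      rw [putCell_of_ne (by decide)]; simp [f8, f7, f6, f5]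
    have e1' : m₃ 1 = m 1 := by simp [f3, f2, f1]
    have e7' : m₃ 7 = m 7 := by simp [f3, f2, f1]
    have e8' : m₃ 8 = m 8 := by simp [f3, f2, f1]
    have e13' : m₃ 13 = m 13 := by simp [f3, f2, f1]
    have e16' : m₃ 16 = m 16 := by simp [f3, f2, f1]
    rw [rowAt_congr e1, h1, rowAt_congr e1', rowAt_congr e7', rowAt_congr e8', e13', e16']
  · have e7 : putCell m₈ 17 0 0 (m 17 0 0 + 1) 7 = m₇ 7 := by
      rw [putCell_of_ne (by decide)]; simp [f8]
    have e7' : m₆ 7 = m 7 := by simp [f6, f5, f4, f3, f2, f1]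
    rw [rowAt_congr e7, h7, rowAt_congr e7', rowsAt_congr e4, h4, Finset.sum_neg_distrib,
      sub_neg_eq_add]
  · have e2 : putCell m₈ 17 0 0 (m 17 0 0 + 1) 2 = m₅ 2 := by
      rw [putCell_of_ne (by decide)]; simp [f8, f7, f6]
    have e2' : m₄ 2 = m 2 := by simp [f4, f3, f2, f1]
    have e5' : m₄ 5 = m₃ 5 := by simp [f4]
    rw [rowsAt_congr e2, h2, rowsAt_congr e2', rowsAt_congr e5', h5]
  · have e6 : putCell m₈ 17 0 0 (m 17 0 0 + 1) 6 = m₆ 6 := by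
      rw [putCell_of_ne (by decide)]; simp [f8, f7]
    have e6' : m₅ 6 = m 6 := by simp [f5, f4, f3, f2, f1]
    have e4' : m₅ 4 = m₂ 4 := by simp [f5, f4, f3]
    rw [rowsAt_congr e6, h6, rowsAt_congr e6', rowsAt_congr e4', h4]
    funext i
    simp
  · rw [putCell_of_ne (by decide)]
    exact ⟨hle, hall, hatt⟩

/-! ### Running a phase -/

open scoped Pointwise

/-- Prepare a phase: set the parameters and reset the sums. -/
def Prog.resetSums : Prog :=
  .seq (.setScalar 16 (.div (.mul (.scalar 15) (.scalar 14)) (.mul (.const 72) (.scalar 13)))) <|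
  .seq (.setScalar 18 (.div (.add (.const 3) (.log (.ofIndex (.reg 0))))
    (.mul (.scalar 16) (.scalar 16)))) <|
  .seq (.setScalar 17 (.const 0)) <|
  .seq (.setScalar 12 (.const 0)) <|
  .seq (.forCol <| .setCell 1 (.const 0) (.reg 3) (.const 0)) <|
  .seq (.forCol <| .setCell 7 (.const 0) (.reg 3) (.const 0)) <|
  .seq (.forRow <| .forCol <| .setCell 2 (.reg 2) (.reg 3) (.const 0)) <|
  .forRow <| .forCol <| .setCell 6 (.reg 2) (.reg 3) (.const 0)

theorem Runs.resetSums (hn : 1 ≤ n) (hd : 1 ≤ d) (m : Mem) (k : ℕ) {θ : ℝ}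
    (hθ : θ = m 15 0 0 * m 14 0 0 / (72 * m 13 0 0)) :
    ∃ m', Runs sub (d * n) .resetSums (stateAt n d 0 0 m k) (stateAt n d 0 0 m' k) ∧
      (∀ C, (C = 0 ∨ C = 8 ∨ (13 ≤ C ∧ C ≤ 15) ∨ 19 ≤ C) → m' C = m C) ∧
      m' 16 0 0 = θ ∧ m' 18 0 0 = (3 + Real.log n) / θ ^ 2 ∧ m' 17 0 0 = 0 ∧ m' 12 0 0 = 0 ∧
      rowAt d m' 1 0 = 0 ∧ rowAt d m' 7 0 = 0 ∧ rowsAt n d m' 2 = 0 ∧ rowsAt n d m' 6 = 0 := by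
  have hd' : (1 : ℝ) ≤ d := by exact_mod_cast hd
  have hn' : (1 : ℝ) ≤ n := by exact_mod_cast hn
  have hdX : (d : ℝ) ≤ d * n := by nlinarith
  have hX1 : 1 ≤ (d * n : ℝ) := hd'.trans hdX
  have r1 := Runs.setScalar (sub := sub) (i := 0) (j := 0) (k := k) (m := m) (A := 16)
    (e := .div (.mul (.scalar 15) (.scalar 14)) (.mul (.const 72) (.scalar 13))) (x := θ) hX1
    (by simp [hθ])
  have r2 := Runs.setScalar (sub := sub) (i := 0) (j := 0) (k := k) (m := putCell m 16 0 0 θ)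
    (A := 18) (e := .div (.add (.const 3) (.log (.ofIndex (.reg 0))))
      (.mul (.scalar 16) (.scalar 16))) (x := (3 + Real.log n) / θ ^ 2) hX1
    (by simp [putCell_self, sq])
  set m₂ := putCell (putCell m 16 0 0 θ) 18 0 0 ((3 + Real.log n) / θ ^ 2) with hm₂
  have r3 := Runs.setScalar (sub := sub) (i := 0) (j := 0) (k := k) (m := m₂) (A := 17)
    (e := .const 0) (x := 0) hX1 (by simp)
  have r4 := Runs.setScalar (sub := sub) (i := 0) (j := 0) (k := k) (m := putCell m₂ 17 0 0 0)
    (A := 12) (e := .const 0) (x := 0) hX1 (by simp)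
  have r5 := Runs.fillRow (sub := sub) (i := 0) (k := k)
    (m := putCell (putCell m₂ 17 0 0 0) 12 0 0 0) (A := 1) (a := .const 0) (r := 0)
    (e := .const 0) (f := fun _ => 0) hd (fun _ _ => rfl) (by simp)
  set m₅ := putRow (putCell (putCell m₂ 17 0 0 0) 12 0 0 0) 1 0 d fun _ => 0 with hm₅
  have r6 := Runs.fillRow (sub := sub) (i := 0) (k := k) (m := m₅) (A := 7) (a := .const 0)
    (r := 0) (e := .const 0) (f := fun _ => 0) hd (fun _ _ => rfl) (by simp)
  set m₆ := putRow m₅ 7 0 d fun _ => 0 with hm₆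
  have r7 := Runs.fillBlock (sub := sub) (k := k) (m := m₆) (A := 2)
    (e := .const 0) (f := fun _ _ => 0) hn hd (by simp)
  set m₇ := putBlock m₆ 2 n d fun _ _ => 0 with hm₇
  have r8 := Runs.fillBlock (sub := sub) (k := k) (m := m₇) (A := 6)
    (e := .const 0) (f := fun _ _ => 0) hn hd (by simp)
  refine ⟨_, r1.seq <| r2.seq <| r3.seq <| r4.seq <| (r5.mono hdX).seq <| (r6.mono hdX).seq <|
    r7.seq r8, fun C hC => ?_, ?_, ?_, ?_, ?_, ?_, ?_, ?_, ?_⟩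
  · rw [putBlock_of_ne (by omega), hm₇, putBlock_of_ne (by omega), hm₆, putRow_of_ne (by omega),
      hm₅, putRow_of_ne (by omega), putCell_of_ne (by omega), putCell_of_ne (by omega), hm₂,
      putCell_of_ne (by omega), putCell_of_ne (by omega)]
  · simp [m₇, m₆, m₅, m₂, putBlock, putRow, putCell]
  · simp [m₇, m₆, m₅, m₂, putBlock, putRow, putCell]
  · simp [m₇, m₆, m₅, m₂, putBlock, putRow, putCell]
  · simp [m₇, m₆, m₅, m₂, putBlock, putRow, putCell]
  · ext j
    simp [m₇, m₆, m₅, putBlock, putRow]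
  · ext j
    simp [m₇, m₆, m₅, putBlock, putRow]
  · funext i
    ext j
    simp [m₇, putBlock, rowsAt]
  · funext i
    ext j
    simp [m₇, putBlock, rowsAt]

/-- All rounds of a phase. -/
def Prog.rounds : Prog := .loop (.ltR (.scalar 17) (.scalar 18)) .round

/-- The memory invariant of the rounds of a phase. -/
def MemInv (Ω : Fin n → Set (E d)) (t : ℕ) (m : Mem) : Prop :=
  m 17 0 0 = t ∧
  (m 12 0 0 = 0 ∨ ∃ i, ∃ v ∈ Ω i, m 12 0 0 = ‖v - rowAt d m 8 0‖ ^ 2) ∧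
  (∀ i, rowsAt n d m 2 i ∈ (t : ℝ) • Ω i) ∧
  -- The analysis is needed only if no answer so far was farther than `D` from the reference point;
  -- otherwise the phase is discarded.
  (m 12 0 0 ≤ m 13 0 0 ^ 2 → RoundInv Ω (rowAt d m 8 0) (m 13 0 0) (m 16 0 0) t
    (rowAt d m 1 0) (rowAt d m 7 0) (rowsAt n d m 2) (rowsAt n d m 6))

theorem Runs.rounds (hn : 1 < n) (hd : 1 ≤ d) {X : ℝ} (hX : (d : ℝ) * n ≤ X)
    {Ω : Fin n → Set (E d)} (hsolves : sub.Solves Ω) (hconv : ∀ i, Convex ℝ (Ω i))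
    (hsub : ∀ k h, (sub.steps k h : ℝ) + 1 ≤ X) {m : Mem} (hD : 0 < m 13 0 0)
    (hθ : 0 < m 16 0 0) (hθ1 : m 16 0 0 ≤ 1 / 72) (hT : 0 < m 18 0 0) (k : ℕ)
    (h0 : MemInv Ω 0 m) :
    ∃ m' k', Runs sub (X * ⌈m 18 0 0⌉₊) .rounds (stateAt n d 0 0 m k) (stateAt n d 0 0 m' k') ∧
      (∀ C, (C = 0 ∨ C = 8 ∨ (13 ≤ C ∧ C ≤ 16) ∨ 18 ≤ C) → m' C = m C) ∧
      MemInv Ω ⌈m 18 0 0⌉₊ m' := by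
  have hd' : (1 : ℝ) ≤ d := by exact_mod_cast hd
  have hn' : (1 : ℝ) ≤ n := by exact_mod_cast hn.le
  obtain ⟨_, h, m', k', rfl, hf, hinv⟩ := Runs.loop (sub := sub) (X := X) (p := .round)
    (b := .ltR (.scalar 17) (.scalar 18)) (N := ⌈m 18 0 0⌉₊) (s := stateAt n d 0 0 m k)
    (P := fun t s => ∃ m' k', s = stateAt n d 0 0 m' k' ∧
      (∀ C, (C = 0 ∨ C = 8 ∨ (13 ≤ C ∧ C ≤ 16) ∨ 18 ≤ C) → m' C = m C) ∧ MemInv Ω t m')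
    (Nat.ceil_pos.2 hT) (by nlinarith)
    (by
      rintro _ ⟨m', k', rfl, hf, h17, -⟩
      simpa [Test.holds, h17, hf 18] using Nat.le_ceil _)
    (by
      rintro t ht _ ⟨m₁, k₁, rfl, hf, h17, hmx, hV, hinv⟩
      refine ⟨by simpa [Test.holds, h17, hf 18] using Nat.lt_ceil.1 ht, ?_⟩
      obtain ⟨m₂, r, f, h1, h7, h2, h6, h17', hle, hall, hatt⟩ :=
        Runs.round (sub := sub) hn.le hd hX hsub m₁ k₁ rfl rfl
      have e8 : rowAt d m₂ 8 0 = rowAt d m₁ 8 0 := rowAt_congr (f 8 (by omega)) 0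
      have hv := hsolves k₁ fun i =>
        -dualVec (m₁ 16 0 0 / m₁ 13 0 0) (rowAt d m₁ 1 0) (rowsAt n d m₁ 2) i
      refine ⟨_, r, m₂, _, rfl, fun C hC => (f C hC).trans (hf C hC), ?_, ?_, ?_, ?_⟩
      · rw [h17', h17]; push_cast; rfl
      · rw [e8]
        rcases hatt with h | ⟨i, h⟩
        · rwa [h]
        · exact .inr ⟨i, _, (hv i).1, h⟩
      · intro i
        rw [h2]
        push_cast
        -- Convexity gives `t • Ωᵢ + Ωᵢ = (t + 1) • Ωᵢ`.
        rw [(hconv i).add_smul (by positivity) zero_le_one, one_smul]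
        exact Set.add_mem_add (hV i) (hv i).1
      · intro hmx'
        rw [f 13 (by omega)] at hmx'
        rw [h1, h2, h6, h7, e8, f 13 (by omega), f 16 (by omega)]
        push_cast
        rw [hf 13 (by omega)] at *
        rw [hf 16 (by omega)] at *
        refine (hinv (hle.trans hmx')).step hn hD hθ hθ1 (fun i => (hv i).2) fun i => ?_
        exact abs_le_of_sq_le_sq' ((hall i).trans hmx') hD.le |>.2)
    ⟨m, k, rfl, fun _ _ => rfl, h0⟩
  exact ⟨m', k', h, hf, hinv⟩

/-- The last call of a phase, and the radius of the average. -/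
def Prog.evaluate : Prog :=
  .seq (.forRow <| .forCol <| .setCell 4 (.reg 2) (.reg 3)
    (.sub (.div (.col 7) (.ofIndex (.reg 0))) (.entry 6))) <|
  .seq (.call 4 5) <|
  .seq (.maxDist 5 8 12) <|
  .seq (.setScalar 20 (.const 0)) <|
  .seq (.maxDist 2 1 20) <|
  .setScalar 3 (.div (.sqrt (.scalar 20)) (.scalar 17))

/-- One more call, at the corrected duals, supplies the points `uᵢ` of the duality argument. Its
answers also enter the test against `D`, since that argument needs them within `D` of the reference
point. -/
theorem Runs.evaluate (hn : 1 < n) (hd : 1 ≤ d) {X : ℝ} (hX : (d : ℝ) * n ≤ X)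
    {Ω : Fin n → Set (E d)} (hne : ∀ i, (Ω i).Nonempty) (hsolves : sub.Solves Ω)
    (hsub : ∀ k h, (sub.steps k h : ℝ) + 1 ≤ X) {m : Mem} (hD : 0 < m 13 0 0)
    (hopt : optRadius Ω ≤ m 13 0 0)
    (hθ : 0 < m 16 0 0) (k : ℕ) {t : ℕ} (ht : (3 + Real.log n) / m 16 0 0 ^ 2 ≤ t)
    (h0 : MemInv Ω t m) :
    ∃ m', Runs sub X .evaluate (stateAt n d 0 0 m k) (stateAt n d 0 0 m' (k + 1)) ∧
      (∀ C, (C = 0 ∨ C = 1 ∨ C = 2 ∨ C = 8 ∨ (13 ≤ C ∧ C ≤ 19)) → m' C = m C) ∧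
      (∀ i, ‖rowAt d m' 1 0 - rowsAt n d m' 2 i‖ ≤ m' 3 0 0 * t) ∧
      (m' 12 0 0 ≤ m 13 0 0 ^ 2 → m' 3 0 0 ≤ optRadius Ω + 18 * m 16 0 0 * m 13 0 0) ∧
      (m 13 0 0 ^ 2 < m' 12 0 0 → ∃ i, ∃ v ∈ Ω i, m 13 0 0 < ‖v - rowAt d m 8 0‖) := by
  have hd' : (1 : ℝ) ≤ d := by exact_mod_cast hd
  have hn' : (1 : ℝ) ≤ n := by exact_mod_cast hn.le
  have hX1 : 1 ≤ X := by nlinarith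
  obtain ⟨h17, hmx, hV, hinv⟩ := h0
  have ht0 : (0 : ℝ) < t := lt_of_lt_of_le (by
    have := Real.log_nonneg hn'
    positivity) ht
  have r1 := Runs.fillBlock (sub := sub) (k := k) (m := m) (A := 4)
    (e := .sub (.div (.col 7) (.ofIndex (.reg 0))) (.entry 6))
    (f := fun i j => m 7 0 j / n - m 6 i j) hn.le hd
    (fun i _ j _ m' h _ => by simp [h])
  set m₁ := putBlock m 4 n d fun i j => m 7 0 j / n - m 6 i j with hm₁
  have f1 : ∀ C, C ≠ 4 → m₁ C = m C := fun C hC => putBlock_of_ne hC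
  set Y := rowsAt n d m 6 with hY
  set S := rowAt d m 7 0 with hS
  have h4 : rowsAt n d m₁ 4 = fun i => -(Y i - (n : ℝ)⁻¹ • S) := by
    rw [hm₁, rowsAt_putBlock]
    funext i
    ext j
    simp [hY, hS, rowsAt]
    ring
  obtain ⟨m₂, r2, f2, h5⟩ := Runs.call hsub m₁ k
  rw [h4] at h5
  obtain ⟨m₃, r3, f3, hle, hall, hatt⟩ := Runs.maxDist (sub := sub) hn.le hd (A := 5) (B := 8)
    (X := 12) (by decide) (by decide) (by decide) (by decide) (by decide) m₂ (k + 1)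
  have r4 := Runs.setScalar (sub := sub) (i := 0) (j := 0) (k := k + 1) (m := m₃) (A := 20)
    (e := .const 0) (x := 0) hX1 (by simp)
  set m₄ := putCell m₃ 20 0 0 0 with hm₄
  have f4 : ∀ C, C ≠ 20 → m₄ C = m₃ C := fun C hC => putCell_of_ne hC
  obtain ⟨m₅, r5, f5, hle', hall', hatt'⟩ := Runs.maxDist (sub := sub) hn.le hd (A := 2) (B := 1)
    (X := 20) (by decide) (by decide) (by decide) (by decide) (by decide) m₄ (k + 1)
  have r6 := Runs.setScalar (sub := sub) (i := 0) (j := 0) (k := k + 1) (m := m₅) (A := 3)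
    (e := .div (.sqrt (.scalar 20)) (.scalar 17)) (x := √(m₅ 20 0 0) / t) hX1
    (by simp [f5, f4, f3, f2, f1, h17])
  have f6 : ∀ C, C ≠ 3 → putCell m₅ 3 0 0 (√(m₅ 20 0 0) / t) C = m₅ C :=
    fun C hC => putCell_of_ne hC
  set m₆ := putCell m₅ 3 0 0 (√(m₅ 20 0 0) / t) with hm₆
  have e3 : m₆ 3 0 0 = √(m₅ 20 0 0) / t := putCell_self
  have e1 : m₆ 1 = m 1 := by simp [f6, f5, f4, f3, f2, f1]
  have e2 : m₆ 2 = m 2 := by simp [f6, f5, f4, f3, f2, f1]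
  have e12 : m₆ 12 = m₃ 12 := by simp [f6, f5, f4]
  have e1' : m₄ 1 = m 1 := by simp [f4, f3, f2, f1]
  have e2' : m₄ 2 = m 2 := by simp [f4, f3, f2, f1]
  have e8' : m₂ 8 = m 8 := by simp [f2, f1]
  have e12' : m₂ 12 = m 12 := by simp [f2, f1]
  have e20 : m₄ 20 0 0 = 0 := putCell_self
  rw [rowAt_congr e1', rowsAt_congr e2'] at hall' hatt'
  rw [h5, rowAt_congr e8'] at hall hatt
  rw [e12'] at hle hatt
  rw [e20] at hatt'
  have hu := hsolves k fun i => -(Y i - (n : ℝ)⁻¹ • S)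
  refine ⟨m₆, (r1.mono hX).seq <| r2.seq <| (r3.mono hX).seq <| r4.seq <| (r5.mono hX).seq r6,
    ?_, ?_, ?_, ?_⟩
  · intro C hC
    rw [f6 C (by omega), f5 C (by omega) (by omega), f4 C (by omega),
      f3 C (by omega) (by omega), f2 C (by omega), f1 C (by omega)]
  · intro i
    rw [e3, div_mul_cancel₀ _ ht0.ne', rowAt_congr e1, rowsAt_congr e2, norm_sub_rev]
    exact Real.le_sqrt_of_sq_le (hall' i)
  · intro hmxD
    rw [e12] at hmxD
    have hb := fun i => (hinv (hle.trans hmxD)).norm_sub_le hn hne hD hθ ht (fun i => (hu i).1)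
      (fun i => (hu i).2) (fun i => abs_le_of_sq_le_sq' ((hall i).trans hmxD) hD.le |>.2) hopt i
    rw [e3, div_le_iff₀ ht0]
    rcases hatt' with h | ⟨i, h⟩
    · rw [h, Real.sqrt_zero]
      exact (norm_nonneg _).trans (hb ⟨0, by omega⟩)
    · rw [h, Real.sqrt_sq (norm_nonneg _), norm_sub_rev]
      exact hb i
  · intro hmxD
    rw [e12] at hmxD
    -- The initial value `0` of the maximum cannot exceed `D²`, so the maximum comes from an answer.
    have key : ∃ i, ∃ v ∈ Ω i, m₃ 12 0 0 = ‖v - rowAt d m 8 0‖ ^ 2 := by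
      rcases hatt with h | ⟨i, h⟩
      · rw [h] at hmxD ⊢
        exact hmx.resolve_left fun h0 => by rw [h0] at hmxD; nlinarith
      · exact ⟨i, _, (hu i).1, h⟩
    obtain ⟨i, v, hv, h⟩ := key
    rw [h] at hmxD
    exact ⟨i, v, hv, lt_of_pow_lt_pow_left₀ 2 (norm_nonneg _) hmxD⟩

theorem feasible_average {Ω : Fin n → Set (E d)} {Z : E d} {V : Fin n → E d} {t r : ℝ}
    (ht : 0 < t) (hV : ∀ i, V i ∈ t • Ω i) (hr : ∀ i, ‖Z - V i‖ ≤ r * t) :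
    Feasible Ω (t⁻¹ • Z) (fun i => t⁻¹ • V i) r := by
  refine ⟨fun i => ?_, fun i => (Set.mem_smul_set_iff_inv_smul_mem₀ ht.ne' _ _).1 (hV i)⟩
  rw [← smul_sub, norm_smul, Real.norm_of_nonneg (by positivity), inv_mul_le_iff₀ ht, mul_comm]
  exact hr i

/-- A phase. -/
def Prog.phase : Prog :=
  .seq .resetSums <| .seq .rounds <| .seq .evaluate <|
  .branch (.ltR (.mul (.scalar 13) (.scalar 13)) (.scalar 12))
    (.setScalar 13 (.mul (.const 2) (.scalar 13)))
    (.branch (.ltR (.scalar 3) (.div (.scalar 14) (.const 2)))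
      (.setScalar 14 (.div (.scalar 14) (.const 2)))
      (.setScalar 19 (.const 1)))

/-- The memory between phases: `D = m 13 0 0` is at most twice the diameter, `ρ = m 14 0 0` is at
least the optimal radius. -/
def PhaseInv (Ω : Fin n → Set (E d)) (e : ℝ) (m : Mem) : Prop :=
  m 15 0 0 = e ∧ m 19 0 0 = 0 ∧ m 14 0 0 ≤ m 13 0 0 ∧ optRadius Ω ≤ m 14 0 0 ∧
    m 13 0 0 ≤ 2 * inputDiam Ω ∧ ∃ i, rowAt d m 8 0 ∈ Ω i

/-- The memory after the last phase. -/
def FinalInv (Ω : Fin n → Set (E d)) (e : ℝ) (m : Mem) : Prop :=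
  0 < m 17 0 0 ∧ m 19 0 0 = 1 ∧ (∀ i, rowsAt n d m 2 i ∈ m 17 0 0 • Ω i) ∧
  (∀ i, ‖rowAt d m 1 0 - rowsAt n d m 2 i‖ ≤ m 3 0 0 * m 17 0 0) ∧
  m 3 0 0 ≤ (1 + e) * optRadius Ω

/-- An exceeded guess satisfies `D < ‖v - c‖ ≤ inputDiam Ω`, so `2D` is still at most twice the
diameter. A radius below `ρ/2` is attained by a feasible solution, so `ρ/2` still bounds `r*`.
Either way `D/ρ` doubles. -/
theorem Runs.phase (hn : 1 < n) (hd : 1 ≤ d) {X : ℝ} (hX : (d : ℝ) * n ≤ X)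
    {Ω : Fin n → Set (E d)} (hne : ∀ i, (Ω i).Nonempty) (hcpt : ∀ i, IsCompact (Ω i))
    (hconv : ∀ i, Convex ℝ (Ω i)) (hpos : 0 < optRadius Ω)
    (hsolves : sub.Solves Ω) (hsub : ∀ k h, (sub.steps k h : ℝ) + 1 ≤ X)
    {e : ℝ} (he : 0 < e) (he1 : e ≤ 1) {m : Mem} (hm : PhaseInv Ω e m) (k : ℕ) :
    ∃ N : ℕ, (N : ℝ) ≤ (1 + 5184 * (3 + Real.log n) / e ^ 2) * (m 13 0 0 / m 14 0 0) ^ 2 ∧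
      ∃ m' k', Runs sub (X * N) .phase (stateAt n d 0 0 m k) (stateAt n d 0 0 m' k') ∧
        (FinalInv Ω e m' ∨
          PhaseInv Ω e m' ∧ m' 13 0 0 / m' 14 0 0 = 2 * (m 13 0 0 / m 14 0 0)) := by
  have hd' : (1 : ℝ) ≤ d := by exact_mod_cast hd
  have hn' : (1 : ℝ) ≤ n := by exact_mod_cast hn.le
  have hX1 : 1 ≤ X := by nlinarith
  have hlog := Real.log_nonneg hn'
  obtain ⟨h15, h19, hρD, hoptρ, hDdiam, i₀, hc⟩ := hm
  set D := m 13 0 0 with hDdef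
  set ρ := m 14 0 0 with hρdef
  have hρ : 0 < ρ := hpos.trans_le hoptρ
  have hD : 0 < D := hρ.trans_le hρD
  set θ := e * ρ / (72 * D) with hθdef
  have hθ : 0 < θ := by positivity
  have hθ1 : θ ≤ 1 / 72 := by
    rw [hθdef, div_le_div_iff₀ (by positivity) (by norm_num)]
    nlinarith
  set T := (3 + Real.log n) / θ ^ 2 with hT
  have hT0 : 0 < T := by positivity
  obtain ⟨m₁, r1, f1, h16, h18, h17, h12, hZ, hS, hV, hY⟩ :=
    Runs.resetSums (sub := sub) hn.le hd m k (θ := θ) (by rw [h15])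
  have h13 : m₁ 13 0 0 = D := by rw [f1 13 (by omega)]
  have hinv : MemInv Ω 0 m₁ := by
    refine ⟨by simp [h17], .inl h12, fun i => ?_, fun _ => ?_⟩
    · rw [hV, Nat.cast_zero, Set.zero_smul_set (hne i)]
      rfl
    · rw [hZ, hS, hV, hY, Nat.cast_zero]
      exact RoundInv.zero _ _ _ _
  obtain ⟨m₂, k₂, r2, f2, hinv2⟩ := Runs.rounds hn hd hX hsolves hconv hsub
    (by rw [h13]; exact hD) (by rw [h16]; exact hθ) (by rw [h16]; exact hθ1)
    (by rw [h18]; exact hT0) k hinv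
  rw [h18] at r2 hinv2
  set N := ⌈T⌉₊ with hN
  have hN1 : (1 : ℝ) ≤ N := by exact_mod_cast Nat.ceil_pos.2 hT0
  have hTN : T ≤ N := Nat.le_ceil T
  have h13' : m₂ 13 0 0 = D := by rw [f2 13 (by omega), h13]
  have h16' : m₂ 16 0 0 = θ := by rw [f2 16 (by omega), h16]
  obtain ⟨m₃, r3, f3, hrad, hgood, hbad⟩ := Runs.evaluate hn hd hX hne hsolves hsub
    (by rw [h13']; exact hD) (by rw [h13']; exact hoptρ.trans hρD) (by rw [h16']; exact hθ) k₂
    (by rw [h16']; exact hTN) hinv2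
  have frame : ∀ C, (C = 8 ∨ (13 ≤ C ∧ C ≤ 15) ∨ C = 19) → m₃ C = m C := fun C hC => by
    rw [f3 C (by omega), f2 C (by omega), f1 C (by omega)]
  have e8' : m₂ 8 = m 8 := by rw [f2 8 (by omega), f1 8 (by omega)]
  rw [h13', h16'] at hgood
  rw [h13', rowAt_congr e8'] at hbad
  have e13 : m₃ 13 0 0 = D := by rw [frame 13 (by omega)]
  have e14 : m₃ 14 0 0 = ρ := by rw [frame 14 (by omega)]
  have e15 : m₃ 15 0 0 = e := by rw [frame 15 (by omega), h15]
  have e19 : m₃ 19 0 0 = 0 := by rw [frame 19 (by omega), h19]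
  have e17 : m₃ 17 0 0 = N := by rw [f3 17 (by omega), hinv2.1]
  have hXN : X ≤ X * N := le_mul_of_one_le_right (by linarith) hN1
  have r123 := fun {q s} (h : Runs sub X q (stateAt n d 0 0 m₃ (k₂ + 1)) s) =>
    (r1.mono (hX.trans hXN)).seq <| r2.seq <| (r3.mono hXN).seq <| h.mono hXN
  refine ⟨N, ?_, ?_⟩
  · have h1 : (N : ℝ) ≤ T + 1 := (Nat.ceil_lt_add_one hT0.le).le
    -- The factor `5184 = 72²` comes from the definition of `θ`. The rounding of `T` is paid for by
    -- `1 ≤ (D/ρ)²`.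
    have h2 : T = 5184 * (3 + Real.log n) / e ^ 2 * (D / ρ) ^ 2 := by
      rw [hT, hθdef]
      field_simp
      norm_num
    have h3 : 1 ≤ (D / ρ) ^ 2 := one_le_pow₀ ((one_le_div hρ).2 hρD)
    rw [add_mul, ← h2]
    linarith
  · by_cases hb : D * D < m₃ 12 0 0
    · refine ⟨putCell m₃ 13 0 0 (2 * D), k₂ + 1, r123 <| .branchTrue hX1
        (by simpa [Test.holds, e13] using hb) (.setScalar hX1 (by simp [e13])), .inr ⟨?_, ?_⟩⟩
      · obtain ⟨i, v, hv, hlt⟩ := hbad (by rwa [sq])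
        have hle := norm_sub_le_inputDiam hcpt hv hc
        have e8 : putCell m₃ 13 0 0 (2 * D) 8 = m 8 := by
          rw [putCell_of_ne (by decide), frame 8 (by omega)]
        refine ⟨?_, ?_, ?_, ?_, ?_, i₀, ?_⟩
        · rwa [putCell_of_ne (by decide)]
        · rwa [putCell_of_ne (by decide)]
        · rw [putCell_of_ne (by decide), putCell_self, e14]; linarith
        · rwa [putCell_of_ne (by decide), e14]
        · rw [putCell_self]; linarith
        · rwa [rowAt_congr e8]
      · rw [putCell_self, putCell_of_ne (by decide), e14]
        ring
    · have hgood' := hgood (by rw [sq]; exact not_lt.1 hb)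
      have e18 : 18 * θ * D = e * ρ / 4 := by
        rw [hθdef]
        field_simp
        norm_num
      rw [e18] at hgood'
      by_cases hr : m₃ 3 0 0 < ρ / 2
      · refine ⟨putCell m₃ 14 0 0 (ρ / 2), k₂ + 1, r123 <| .branchFalse hX1
          (by simpa [Test.holds, e13] using hb) (.branchTrue hX1
          (by simpa [Test.holds, e14] using hr) (.setScalar hX1 (by simp [e14]))),
          .inr ⟨?_, ?_⟩⟩
        · have e8 : putCell m₃ 14 0 0 (ρ / 2) 8 = m 8 := by
            rw [putCell_of_ne (by decide), frame 8 (by omega)]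
          have hopt2 : optRadius Ω ≤ m₃ 3 0 0 := by
            have e2 : m₃ 2 = m₂ 2 := f3 2 (by omega)
            refine optRadius_le hn (feasible_average (by linarith) (fun i => ?_) hrad)
            rw [rowsAt_congr e2]
            exact hinv2.2.2.1 i
          refine ⟨?_, ?_, ?_, ?_, ?_, i₀, ?_⟩
          · rwa [putCell_of_ne (by decide)]
          · rwa [putCell_of_ne (by decide)]
          · rw [putCell_self, putCell_of_ne (by decide), e13]; linarith
          · rw [putCell_self]; linarith
          · rwa [putCell_of_ne (by decide), e13]
          · rwa [rowAt_congr e8]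
        · rw [putCell_self, putCell_of_ne (by decide), e13]
          field_simp
      · refine ⟨putCell m₃ 19 0 0 1, k₂ + 1, r123 <| .branchFalse hX1
          (by simpa [Test.holds, e13] using hb) (.branchFalse hX1
          (by simpa [Test.holds, e14] using hr) (.setScalar hX1 (by simp))),
          .inl ⟨?_, putCell_self, ?_, ?_, ?_⟩⟩
        · rw [putCell_of_ne (by decide), e17]; linarith
        · have e2 : putCell m₃ 19 0 0 1 2 = m₂ 2 := by
            rw [putCell_of_ne (by decide), f3 2 (by omega)]
          rw [putCell_of_ne (by decide), e17, rowsAt_congr e2]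
          exact hinv2.2.2.1
        · have e2 : putCell m₃ 19 0 0 1 2 = m₃ 2 := putCell_of_ne (by decide)
          have e1 : putCell m₃ 19 0 0 1 1 = m₃ 1 := putCell_of_ne (by decide)
          rw [rowsAt_congr e2, rowAt_congr e1, putCell_of_ne (by decide),
            putCell_of_ne (by decide), e17]
          exact hrad
        · rw [putCell_of_ne (by decide)]
          rw [not_lt] at hr
          -- With `r ≥ ρ/2` the bound `r ≤ r* + eρ/4` gives `r * (1 - e/2) ≤ r*`, and `(1 + e) * (1
          -- - e/2) ≥ 1` because `e ≤ 1`.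
          have h1 := mul_le_mul_of_nonneg_left hgood' (by linarith : 0 ≤ 1 + e)
          have h2 := mul_le_mul_of_nonneg_left hr he.le
          have h3 : e * (e * ρ) ≤ 1 * (e * ρ) := by gcongr
          linarith

/-! ### The complete algorithm -/

/-- All phases. -/
def Prog.phases : Prog := .loop (.ltR (.scalar 19) (.const 1)) .phase

theorem Runs.loop_cons {b : Test} {p : Prog} {s s' s'' : State} {X N L : ℝ} (hXN : 1 ≤ X * N)
    (hb : b.holds s) (h : Runs sub (X * N) p s s') (h' : Runs sub (X * L) (.loop b p) s' s'') :
    Runs sub (X * (N + L)) (.loop b p) s s'' := by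
  obtain ⟨t, ht, hc⟩ := h
  obtain ⟨t', ht', hc'⟩ := h'
  refine ⟨_, .loopTrue hb ht ht', ?_⟩
  simp only [Prog.weight] at hc' ⊢
  push_cast at hc' ⊢
  have h1 : (b.cost : ℝ) ≤ b.cost * (X * N) := le_mul_of_one_le_right (by positivity) hXN
  have h2 : 0 ≤ b.cost * (X * N) := by positivity
  linarith

theorem Runs.loop_nil {b : Test} {p : Prog} {s : State} {X : ℝ} (hX : 1 ≤ X)
    (hb : ¬ b.holds s) : Runs sub X (.loop b p) s s := by
  refine ⟨_, .loopFalse hb, ?_⟩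
  simp only [Prog.weight]
  push_cast
  have h1 : (b.cost : ℝ) ≤ b.cost * X := le_mul_of_one_le_right (by positivity) hX
  have h2 : 0 ≤ (p.weight : ℝ) * X := by positivity
  nlinarith

/-- With `M = D/ρ`, the bound telescopes: `M² + (16R² - (2M)²)/3 = (16R² - M²)/3`. The exponent `κ`
bounds the number of phases left, as `M` doubles and never exceeds `2R`. -/
theorem Runs.phases (hn : 1 < n) (hd : 1 ≤ d) {X : ℝ} (hX : (d : ℝ) * n ≤ X)
    {Ω : Fin n → Set (E d)} (hne : ∀ i, (Ω i).Nonempty) (hcpt : ∀ i, IsCompact (Ω i))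
    (hconv : ∀ i, Convex ℝ (Ω i)) (hpos : 0 < optRadius Ω)
    (hsolves : sub.Solves Ω) (hsub : ∀ k h, (sub.steps k h : ℝ) + 1 ≤ X)
    {e G : ℝ} (he : 0 < e) (he1 : e ≤ 1) (hG : G = 1 + 5184 * (3 + Real.log n) / e ^ 2)
    (κ : ℕ) : ∀ (m : Mem) (k : ℕ), PhaseInv Ω e m →
      2 * ratio Ω < m 13 0 0 / m 14 0 0 * 2 ^ κ →
      ∃ m' k', Runs sub (X * (G * (16 * ratio Ω ^ 2 - (m 13 0 0 / m 14 0 0) ^ 2) / 3 + 1))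
        .phases (stateAt n d 0 0 m k) (stateAt n d 0 0 m' k') ∧ FinalInv Ω e m' := by
  have hd' : (1 : ℝ) ≤ d := by exact_mod_cast hd
  have hn' : (1 : ℝ) ≤ n := by exact_mod_cast hn.le
  have hX1 : 1 ≤ X := by nlinarith
  have hlog := Real.log_nonneg hn'
  have hG0 : 0 < G := by rw [hG]; positivity
  have hle : ∀ m : Mem, PhaseInv Ω e m → m 13 0 0 / m 14 0 0 ≤ 2 * ratio Ω := by
    rintro m ⟨-, -, hρD, hoptρ, hDd, -⟩
    rw [ratio, ← mul_div_assoc]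
    have := hpos.trans_le (hoptρ.trans hρD)
    gcongr
    linarith
  have hge : ∀ m : Mem, PhaseInv Ω e m → 1 ≤ m 13 0 0 / m 14 0 0 := by
    rintro m ⟨-, -, hρD, hoptρ, -, -⟩
    exact (one_le_div (hpos.trans_le hoptρ)).2 hρD
  induction κ with
  | zero =>
    intro m k hm h
    linarith [hle m hm]
  | succ κ ih =>
    intro m k hm h
    have hM := hle m hm
    have hM1 := hge m hm
    obtain ⟨N, hN, m₁, k₁, r, hfin⟩ := Runs.phase hn hd hX hne hcpt hconv hpos hsolves hsub he he1
      hm k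
    rw [← hG] at hN
    have htest : (Test.ltR (.scalar 19) (.const 1)).holds (stateAt n d 0 0 m k) := by
      simp [Test.holds, hm.2.1]
    set M := m 13 0 0 / m 14 0 0
    have hMsq : M ^ 2 ≤ 4 * ratio Ω ^ 2 := by nlinarith
    have hGM : 1 ≤ G * M ^ 2 := by
      have : 1 ≤ G := by rw [hG]; linarith [(by positivity : 0 ≤ 5184 * (3 + Real.log n) / e ^ 2)]
      nlinarith
    have r' := r.mono (mul_le_mul_of_nonneg_left hN (by linarith))
    have hXN : 1 ≤ X * (G * M ^ 2) := one_le_mul_of_one_le_of_one_le hX1 hGM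
    rcases hfin with hfin | ⟨hm₁, hM₁⟩
    · refine ⟨m₁, k₁, (Runs.loop_cons (L := 1) hXN htest r' (.loop_nil (by linarith) ?_)).mono ?_,
        hfin⟩
      · simp [Test.holds, hfin.2.1]
      -- In the last phase `M² ≤ (16R² - M²)/3`, by `M ≤ 2R`; the summand `1` pays for the final
      -- test.
      · gcongr
        nlinarith
    · obtain ⟨m₂, k₂, r₂, hfin⟩ := ih m₁ k₁ hm₁ (by rw [hM₁]; rw [pow_succ] at h; linarith)
      rw [hM₁] at r₂
      refine ⟨m₂, k₂, (Runs.loop_cons hXN htest r' r₂).mono (le_of_eq ?_), hfin⟩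
      ring

/-! ### Initialization, output and total cost -/

/-- The initialization. -/
def Prog.start : Prog :=
  .seq (.call 4 5) <|
  .seq (.forCol <| .setCell 8 (.const 0) (.reg 3) (.col 5)) <|
  .seq (.maxDist 5 8 12) <|
  .seq (.setScalar 13 (.sqrt (.scalar 12))) <|
  .seq (.setScalar 14 (.scalar 13)) <|
  .branch (.ltR (.scalar 0) (.const 1)) (.setScalar 15 (.scalar 0)) (.setScalar 15 (.const 1))

theorem input_eq_stateAt (n d : ℕ) (ε : ℝ) :
    State.input n d ε = stateAt n d 0 0 (putCell (fun _ _ _ => 0) 0 0 0 ε) 0 := by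
  simp only [State.input, stateAt, State.mk.injEq, and_true]
  constructor
  · funext x
    split_ifs <;> rfl
  · rfl

/-- The first call, with zero vectors, yields a point of every set. With `c` the first of them and
`D` the largest distance from it, `c` and these points form a feasible solution of radius `D`, so
`r* ≤ D ≤ inputDiam Ω`, and `ρ = D` is a valid start. -/
theorem Runs.start (hn : 1 < n) (hd : 1 ≤ d) {X : ℝ} (hX : (d : ℝ) * n ≤ X)
    {Ω : Fin n → Set (E d)} (hcpt : ∀ i, IsCompact (Ω i)) (hpos : 0 < optRadius Ω)
    (hsolves : sub.Solves Ω) (hsub : ∀ k h, (sub.steps k h : ℝ) + 1 ≤ X) (ε : ℝ) :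
    ∃ m k, Runs sub X .start (State.input n d ε) (stateAt n d 0 0 m k) ∧
      PhaseInv Ω (min ε 1) m ∧ m 13 0 0 / m 14 0 0 = 1 := by
  have hd' : (1 : ℝ) ≤ d := by exact_mod_cast hd
  have hn' : (1 : ℝ) ≤ n := by exact_mod_cast hn.le
  have hdX : (d : ℝ) ≤ X := by nlinarith
  have hX1 : 1 ≤ X := hd'.trans hdX
  rw [input_eq_stateAt]
  set m := putCell (fun _ _ _ => 0) 0 0 0 ε with hm
  obtain ⟨m₁, r1, f1, h5⟩ := Runs.call hsub m 0
  have hu := hsolves 0 (rowsAt n d m 4)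
  rw [← h5] at hu
  have r2 := Runs.fillRow (sub := sub) (i := 0) (k := 1) (m := m₁) (A := 8)
    (a := .const 0) (r := 0) (e := .col 5) (f := fun j => m₁ 5 0 j) hd (fun _ _ => rfl)
    (fun j _ m' h _ => by simp [h])
  set m₂ := putRow m₁ 8 0 d fun j => m₁ 5 0 j with hm₂
  have h8 : rowAt d m₂ 8 0 = rowAt d m₁ 5 0 := rowAt_putRow _ _ _ _
  have f2 : ∀ C, C ≠ 8 → m₂ C = m₁ C := fun C hC => putRow_of_ne hC
  obtain ⟨m₃, r3, f3, hle, hall, hatt⟩ := Runs.maxDist (sub := sub) hn.le hd (A := 5) (B := 8)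
    (X := 12) (by decide) (by decide) (by decide) (by decide) (by decide) m₂ 1
  rw [rowsAt_congr (f2 5 (by decide)), h8] at hall hatt
  have e12 : m₂ 12 0 0 = 0 := by simp [f2, f1, m, putCell]
  rw [e12] at hatt
  set D := √(m₃ 12 0 0) with hD
  have hopt : optRadius Ω ≤ D := by
    refine optRadius_le hn (z := rowAt d m₁ 5 0) (v := rowsAt n d m₁ 5)
      ⟨fun i => ?_, fun i => (hu i).1⟩
    rw [norm_sub_rev]
    exact Real.le_sqrt_of_sq_le (hall i)
  have hD0 : 0 < D := hpos.trans_le hopt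
  have hDdiam : D ≤ inputDiam Ω := by
    rcases hatt with h | ⟨i, h⟩
    · rw [hD, h, Real.sqrt_zero] at hD0
      exact absurd hD0 (lt_irrefl _)
    · rw [hD, h, Real.sqrt_sq (norm_nonneg _)]
      exact norm_sub_le_inputDiam hcpt (hu i).1 (hu ⟨0, by omega⟩).1
  have r4 := Runs.setScalar (sub := sub) (i := 0) (j := 0) (k := 1) (m := m₃) (A := 13)
    (e := .sqrt (.scalar 12)) (x := D) hX1 (by simp [hD])
  have r5 := Runs.setScalar (sub := sub) (i := 0) (j := 0) (k := 1) (m := putCell m₃ 13 0 0 D)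
    (A := 14) (e := .scalar 13) (x := D) hX1 (by simp [putCell_self])
  set m₅ := putCell (putCell m₃ 13 0 0 D) 14 0 0 D with hm₅
  have f5 : ∀ C, C ≠ 11 → C ≠ 12 → C ≠ 13 → C ≠ 14 → m₅ C = m₂ C := fun C h1 h2 h3 h4 => by
    rw [hm₅, putCell_of_ne h4, putCell_of_ne h3, f3 C h1 h2]
  have e0 : m₅ 0 0 0 = ε := by simp [f5, f2, f1, m, putCell]
  have r6 : Runs sub X (.branch (.ltR (.scalar 0) (.const 1)) (.setScalar 15 (.scalar 0))
      (.setScalar 15 (.const 1))) (stateAt n d 0 0 m₅ 1)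
      (stateAt n d 0 0 (putCell m₅ 15 0 0 (min ε 1)) 1) := by
    by_cases h : ε < 1
    · exact .branchTrue hX1 (by simpa [Test.holds, e0] using h)
        (.setScalar hX1 (by simp [e0, h.le]))
    · exact .branchFalse hX1 (by simpa [Test.holds, e0] using h)
        (.setScalar hX1 (by simp [not_lt.1 h]))
  have e13 : putCell m₅ 15 0 0 (min ε 1) 13 0 0 = D := by simp [m₅, putCell]
  have e14 : putCell m₅ 15 0 0 (min ε 1) 14 0 0 = D := by simp [m₅, putCell]
  have e8 : putCell m₅ 15 0 0 (min ε 1) 8 = m₂ 8 := by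
    rw [putCell_of_ne (by decide), f5 8 (by decide) (by decide) (by decide) (by decide)]
  refine ⟨_, _, r1.seq <| (r2.mono hdX).seq <| (r3.mono hX).seq <| r4.seq <| r5.seq r6,
    ⟨putCell_self, ?_, ?_, ?_, ?_, ⟨0, by omega⟩, ?_⟩, ?_⟩
  · rw [putCell_of_ne (by decide)]
    simp [f5, f2, f1, m, putCell]
  · rw [e13, e14]
  · rwa [e14]
  · rw [e13]; linarith
  · rw [rowAt_congr e8, h8]
    exact (hu ⟨0, by omega⟩).1
  · rw [e13, e14, div_self hD0.ne']

/-- Divide the sums by the number of rounds. -/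
def Prog.average : Prog :=
  .seq (.forCol <| .setCell 1 (.const 0) (.reg 3) (.div (.col 1) (.scalar 17))) <|
  .forRow <| .forCol <| .setCell 2 (.reg 2) (.reg 3) (.div (.entry 2) (.scalar 17))

theorem Runs.average (hn : 1 < n) (hd : 1 ≤ d) {Ω : Fin n → Set (E d)} {ε : ℝ}
    (hpos : 0 < optRadius Ω) {m : Mem} (h : FinalInv Ω (min ε 1) m) (k : ℕ) :
    ∃ s, Runs sub (d * n) .average (stateAt n d 0 0 m k) s ∧
      IsApproxSolution Ω ε (s.outZ d) (s.outV n d) s.outR := by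
  have hn' : (1 : ℝ) ≤ n := by exact_mod_cast hn.le
  obtain ⟨h17, -, hV, hZ, hr⟩ := h
  have r1 := Runs.fillRow (sub := sub) (i := 0) (k := k) (m := m) (A := 1)
    (a := .const 0) (r := 0) (e := .div (.col 1) (.scalar 17)) (f := fun j => m 1 0 j / m 17 0 0)
    hd (fun _ _ => rfl) (fun j _ m' h h' => by simp [h, h'])
  set m₁ := putRow m 1 0 d fun j => m 1 0 j / m 17 0 0 with hm₁
  have f1 : ∀ C, C ≠ 1 → m₁ C = m C := fun C hC => putRow_of_ne hC
  have r2 := Runs.fillBlock (sub := sub) (k := k) (m := m₁) (A := 2)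
    (e := .div (.entry 2) (.scalar 17)) (f := fun i j => m 2 i j / m 17 0 0)
    hn.le hd (fun i _ j _ m' h h' => by simp [h, h', f1])
  refine ⟨_, (r1.mono (le_mul_of_one_le_right (by positivity) hn')).seq r2, ?_, ?_⟩
  · convert feasible_average h17 hV hZ using 1
    · ext j
      simp [State.outZ, State.row, stateAt, putBlock, m₁, putRow]
      ring
    · funext i
      ext j
      simp [State.outV, State.rows, State.row, stateAt, putBlock, rowsAt]
      ring
    · simp [State.outR, stateAt, putBlock, f1]
  · have : (stateAt n d 0 0 (putBlock m₁ 2 n d fun i j => m 2 i j / m 17 0 0) k).outR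
        = m 3 0 0 := by
      simp [State.outR, stateAt, putBlock, f1]
    rw [this]
    refine hr.trans ?_
    gcongr
    exact min_le_left _ _

/-- The algorithm. -/
def Prog.intersectingBall : Prog := .seq .start <| .seq .phases .average

theorem Runs.intersectingBall (hn : 1 < n) (hd : 1 ≤ d) {X : ℝ} (hX : (d : ℝ) * n ≤ X)
    {Ω : Fin n → Set (E d)} (hne : ∀ i, (Ω i).Nonempty) (hcpt : ∀ i, IsCompact (Ω i))
    (hconv : ∀ i, Convex ℝ (Ω i)) (hpos : 0 < optRadius Ω) (hsolves : sub.Solves Ω)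
    (hsub : ∀ k h, (sub.steps k h : ℝ) + 1 ≤ X) {ε : ℝ} (hε : 0 < ε) :
    ∃ s, Runs sub (X * (300000 * (ratio Ω ^ 2 * Real.log n / min ε 1 ^ 2))) .intersectingBall
        (State.input n d ε) s ∧
      IsApproxSolution Ω ε (s.outZ d) (s.outV n d) s.outR := by
  have hd' : (1 : ℝ) ≤ d := by exact_mod_cast hd
  have hn' : (1 : ℝ) ≤ n := by exact_mod_cast hn.le
  have hX1 : 1 ≤ X := by nlinarith
  have he : 0 < min ε 1 := lt_min hε one_pos
  have he1 : min ε 1 ≤ 1 := min_le_right _ _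
  obtain ⟨m, k, r1, hinv, hM⟩ := Runs.start hn hd hX hcpt hpos hsolves hsub ε
  obtain ⟨κ, hκ⟩ := pow_unbounded_of_one_lt (2 * ratio Ω) one_lt_two
  obtain ⟨m', k', r2, hfin⟩ := Runs.phases hn hd hX hne hcpt hconv hpos hsolves hsub he he1 rfl κ
    m k hinv (by rwa [hM, one_mul])
  obtain ⟨s, r3, hs⟩ := Runs.average (sub := sub) hn hd hpos hfin k'
  rw [hM] at r2
  have hR : 1 ≤ 4 * ratio Ω ^ 2 := by
    obtain ⟨-, -, hρD, hoptρ, hDd, -⟩ := hinv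
    have : 1 ≤ 2 * ratio Ω := by
      rw [ratio, ← mul_div_assoc, one_le_div hpos]
      linarith
    nlinarith
  have hlog : 1 / 2 ≤ Real.log n := by
    have h1 : Real.log 2 ≤ Real.log n :=
      Real.log_le_log two_pos (by exact_mod_cast hn)
    linarith [Real.log_two_gt_d9]
  have he2 : min ε 1 ^ 2 ≤ 1 := pow_le_one₀ he.le he1
  have he2' : 0 < min ε 1 ^ 2 := by positivity
  generalize min ε 1 ^ 2 = a at *
  set Q := Real.log n / a with hQ
  have hQ1 : 1 / 2 ≤ Q := by
    rw [hQ, le_div_iff₀ he2']; linarith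
  -- From `log n ≥ 1/2` one gets `3 + log n ≤ 7 * log n`.
  have hQ3 : 5184 * (3 + Real.log n) / a ≤ 5184 * 7 * Q := by
    have : 5184 * 7 * Q = 5184 * (7 * Real.log n) / a := by rw [hQ]; ring
    rw [this]
    gcongr
    linarith
  have hbound : (1 + 5184 * (3 + Real.log n) / a) * (16 * ratio Ω ^ 2 - 1 ^ 2) / 3 + 1 ≤
      300000 * (ratio Ω ^ 2 * Q) := by
    -- `36290 = 5184 * 7 + 2`, using `1 ≤ 2 * Q`. A third of `36290 * 16`, plus `8` for the summand
    -- `1`, is below `300000`.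
    have h1 : (1 + 5184 * (3 + Real.log n) / a) * (16 * ratio Ω ^ 2 - 1 ^ 2) ≤
        (36290 * Q) * (16 * ratio Ω ^ 2) := by
      have h0 : 0 ≤ 5184 * (3 + Real.log n) / a := by positivity
      refine mul_le_mul (by linarith) (by linarith) (by nlinarith) (by linarith)
    have h2 : 1 ≤ 8 * (ratio Ω ^ 2 * Q) := by nlinarith
    nlinarith
  have hY : 1 ≤ 300000 * (ratio Ω ^ 2 * Q) := by nlinarith
  rw [mul_div_assoc, ← hQ]
  have hXY : X ≤ X * (300000 * (ratio Ω ^ 2 * Q)) := le_mul_of_one_le_right (by linarith) hY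
  exact ⟨s, (r1.mono hXY).seq <| (r2.mono (by gcongr)).seq <| r3.mono (hX.trans hXY), hs⟩

end SIB

theorem mainTheorem1 :
    ∃ P : SIB.Prog, ∀ c : ℝ, 0 < c → ∃ C : ℝ, 0 < C ∧
      ∀ (n d : ℕ) (Ω : Fin n → Set (SIB.E d)),
        1 < n →
        (∀ i, (Ω i).Nonempty) →
        (∀ i, IsCompact (Ω i)) →
        (∀ i, Convex ℝ (Ω i)) →
        (⋂ i, Ω i) = ∅ →
      ∀ (ε : ℝ), 0 < ε →
      ∀ (S : ℝ) (sub : SIB.Subroutine n d),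
        sub.Solves Ω →
        (∀ k h, (sub.steps k h : ℝ) ≤ c * S) →
        ∃ (s : SIB.State) (t : ℕ),
          SIB.Exec sub P (SIB.State.input n d ε) s t ∧
          SIB.IsApproxSolution Ω ε (s.outZ d) (s.outV n d) s.outR ∧
          (t : ℝ) ≤
            C * (SIB.ratio Ω ^ 2 * (S + (n : ℝ) * (d : ℝ)) * Real.log n / (min ε 1) ^ 2) := by
  refine ⟨.intersectingBall, fun c hc =>
    ⟨(SIB.Prog.intersectingBall.weight + 1) * (c + 1) * 300000, by positivity, ?_⟩⟩
  intro n d Ω hn hne hcpt hconv hemp ε hε S sub hsolves hsteps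
  have hpos := SIB.optRadius_pos hn hne hcpt hemp
  -- In dimension `0` nonempty sets share their only point, contrary to the empty intersection.
  have hd : 1 ≤ d := by
    by_contra hd
    obtain rfl : d = 0 := by omega
    have : (0 : SIB.E 0) ∈ ⋂ i, Ω i := Set.mem_iInter.2 fun i => by
      obtain ⟨x, hx⟩ := hne i
      rwa [Subsingleton.elim x 0] at hx
    rw [hemp] at this
    exact this
  have hS : 0 ≤ S := by
    have := (Nat.cast_nonneg _).trans (hsteps 0 0)
    exact nonneg_of_mul_nonneg_right this hc
  have hnd : (1 : ℝ) ≤ n * d := by exact_mod_cast Nat.mul_pos (by omega) hd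
  -- This time scale covers a pass over an `n` by `d` array, and a call with its one extra step
  -- because `n * d ≥ 1`.
  obtain ⟨s, ⟨t, ht, hb⟩, hs⟩ := SIB.Runs.intersectingBall (sub := sub) (X := c * S + n * d) hn hd
    (by nlinarith) hne hcpt hconv hpos hsolves (fun k h => by linarith [hsteps k h]) hε
  refine ⟨s, t, ht, hs, hb.trans ?_⟩
  have hlog := Real.log_nonneg (x := n) (by exact_mod_cast hn.le)
  have hX : c * S + n * d ≤ (c + 1) * (S + n * d) := by nlinarith
  calc _ ≤ ((SIB.Prog.intersectingBall.weight : ℝ) + 1) * ((c + 1) * (S + n * d) *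
        (300000 * (SIB.ratio Ω ^ 2 * Real.log n / min ε 1 ^ 2))) := by
        gcongr
        linarith
    _ = _ := by ring
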